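/- Let $V$, $E$ be finite sets of vertices and edges of a graph in which every vertex is an endpoint of at least one edge; each edge $j\in E$ has two distinct endpoints, and we write $(j,0)\sim v$ if its first endpoint is $v$ and $(j,1)\sim v$ if its second endpoint is $v$ (parallel edges are allowed). Put $\operatorname{sgn}(j,v)=1$ if $(j,0)\sim v$ and $\operatorname{sgn}(j,v)=-1$ if $(j,1)\sim v$. A pair of linear maps $\Gamma_0,\Gamma_1:\operatorname{dom}T\to\mathcal X$ into a Hilbert space $\mathcal X$ is called a boundary triplet $\{\mathcal X,\Gamma_0,\Gamma_1\}$ for an operator $T=S^*$, where $S$ is closed, densely defined and symmetric, if $(\Gamma_0,\Gamma_1):\operatorname{dom}T\to\mathcal X\times\mathcal X$ is surjective and $\langle Tf,g\rangle-\langle f,Tg\rangle=\langle\Gamma_1f,\Gamma_0g\rangle-\langle\Gamma_0f,\Gamma_1g\rangle$ for all $f,g\in\operatorname{dom}T$. For $j\in E$ let $D_j$ be an operator in a complex Hilbert space $X_j$ such that $S_j=\begin{bmatrix}0&iD_j\\ iD_j&0\end{bmatrix}$ is a closed densely defined symmetric operator in $X_j\times X_j$. Let $\hat{\mathcal X}$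 be a complex Hilbert space and let $\Gamma^j_{k,l}:\operatorname{dom}D_j^*\to\hat{\mathcal X}$ ($k,l\in\{0,1\}$) be linear maps such that $$\Gamma_0^j(x_0,x_1)=\begin{bmatrix}\Gamma^j_{0,0}x_0\\ \Gamma^j_{0,1}x_0\end{bmatrix},\qquad \Gamma_1^j(x_0,x_1)=\begin{bmatrix}\Gamma^j_{1,0}x_1\\ -\Gamma^j_{1,1}x_1\end{bmatrix}$$ define a boundary triplet $\{\hat{\mathcal X}\times\hat{\mathcal X},\Gamma_0^j,\Gamma_1^j\}$ for $S_j^*$. Put $X_\oplus=\bigoplus_jX_j$, $D_\oplus=\bigoplus_jD_j$ and $S_\oplus=\begin{bmatrix}0&iD_\oplus\\ iD_\oplus&0\end{bmatrix}$ in $X_\oplus\times X_\oplus$; then $\operatorname{dom}S_\oplus^*=\operatorname{dom}D_\oplus^*\times\operatorname{dom}D_\oplus^*$ with $D_\oplus^*=\bigoplus_jD_j^*$. An element $x=(x_0,x_1)\in\operatorname{dom}S_\oplus^*$ (or just $x_0\in\operatorname{dom}D_\oplus^*$) is called vertex-continuous if for every $v\in V$ all the values $\Gamma^j_{0,k}x_0^j$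 with $(j,k)\sim v$ coincide; the common value is denoted by $(\Gamma_0^\oplus x)(v)$. Let $S_{\oplus,cnt}$ be the restriction of $S_\oplus^*$ to its vertex-continuous elements, and for $x\in\operatorname{dom}S_{\oplus,cnt}$ let $$\Gamma_0^Vx=\big((\Gamma_0^\oplus x)(v)\big)_{v\in V},\qquad \Gamma_1^Vx=\Big(\sum_{(l,k)\sim v}\operatorname{sgn}(l,v)\,\Gamma^l_{1,k}x_1^l\Big)_{v\in V}.$$ Then the following holds. (a) $S_{\oplus,cnt}$ is the adjoint of a closed densely defined symmetric operator, and $\{\hat{\mathcal X}^{|V|},\Gamma_0^V,\Gamma_1^V\}$ is a boundary triplet for $S_{\oplus,cnt}$. (b) Let $S_{node}$ be the restriction of $S_\oplus^*$ to the vertex-continuous $x$ with $\Gamma_1^Vx=0$, and let $D_{node}$ be the restriction of $-D_\oplus^*$ to the vertex-continuous $x_0\in\operatorname{dom}D_\oplus^*$. Then $D_{node}$ is an extension of $D_\oplus$, $S_{node}$ is a self-adjoint extension of $S_\oplus$, and $$S_{node}=\begin{bmatrix}0&(iD_{node})^*\\ iD_{node}&0\end{bmatrix}=\begin{bmatrix}0&-iD_{node}^*\\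 iD_{node}&0\end{bmatrix}.$$ Let $S_0$ be the restriction of $S_\oplus^*$ to the vertex-continuous $x$ with $\Gamma_0^Vx=0$, and let $D_0$ be the restriction of $-D_\oplus^*$ to the $x_0\in\operatorname{dom}D_\oplus^*$ with $\Gamma^j_{0,k}x^j_0=0$ for all $j\in E$, $k\in\{0,1\}$. Then $D_0$ is an extension of $D_\oplus$, its domain is $\{x_0\in\operatorname{dom}D_\oplus\mid \Gamma^j_{0,k}x_0^j=0\text{ for all }j\in E,\ k\in\{0,1\}\}$, $S_0$ is a self-adjoint extension of $S_\oplus$, and $$S_0=\begin{bmatrix}0&(iD_0)^*\\ iD_0&0\end{bmatrix}=\begin{bmatrix}0&-iD_0^*\\ iD_0&0\end{bmatrix}.$$ (c) Let $L=\operatorname{diag}(L_v)_{v\in V}$ with bounded operators $L_v$ on $\hat{\mathcal X}$, and let $S_{\oplus,L}$ be the restriction of $S_\oplus^*$ to the vertex-continuous $x$ with $\Gamma_1^Vx=L\Gamma_0^Vx$. Then $S_{\oplus,L}$ is an extension of $S_\oplus$, and $\operatorname{Im}\langle S_{\oplus,L}x,x\rangle=\operatorname{Im}\langle L\Gamma_0^Vx,\Gamma_0^Vx\rangle$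 for all $x\in\operatorname{dom}S_{\oplus,L}$. If $-iL$ and $iL^*$ are dissipative (an operator $A$ is dissipative if $\operatorname{Re}\langle Ax,x\rangle\le0$ for all $x\in\operatorname{dom}A$), then $-iS_{\oplus,L}$ is the generator of a strongly continuous semigroup of contractions on $X_\oplus\times X_\oplus$. -/

import Mathlib

namespace PortHam

open Filter Topology
open scoped NNReal

section Operators

variable {E F : Type*} [NormedAddCommGroup E] [InnerProductSpace ℂ E]
  [NormedAddCommGroup F] [InnerProductSpace ℂ F]

/-- The off-diagonal block operator `[[0, B], [C, 0]]` on the Hilbert space `E × F` (with the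
sum inner product), with its natural domain `dom C × dom B`. -/
def offDiag (B : F →ₗ.[ℂ] E) (C : E →ₗ.[ℂ] F) :
    WithLp 2 (E × F) →ₗ.[ℂ] WithLp 2 (E × F) where
  domain :=
    { carrier := {x | x.fst ∈ C.domain ∧ x.snd ∈ B.domain}
      zero_mem' := ⟨C.domain.zero_mem, B.domain.zero_mem⟩
      add_mem' := fun hx hy => ⟨C.domain.add_mem hx.1 hy.1, B.domain.add_mem hx.2 hy.2⟩
      smul_mem' := fun c _ hx => ⟨C.domain.smul_mem c hx.1, B.domain.smul_mem c hx.2⟩ }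
  toFun :=
    { toFun := fun x => WithLp.toLp 2 (B ⟨x.1.snd, x.2.2⟩, C ⟨x.1.fst, x.2.1⟩)
      map_add' := fun x y => by
        have h1 := B.map_add ⟨x.1.snd, x.2.2⟩ ⟨y.1.snd, y.2.2⟩
        have h2 := C.map_add ⟨x.1.fst, x.2.1⟩ ⟨y.1.fst, y.2.1⟩
        rw [← WithLp.toLp_add, Prod.mk_add_mk, ← h1, ← h2]
        rfl
      map_smul' := fun c x => by
        have h1 := B.map_smul c ⟨x.1.snd, x.2.2⟩
        have h2 := C.map_smul c ⟨x.1.fst, x.2.1⟩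
        rw [RingHom.id_apply, ← WithLp.toLp_smul, Prod.smul_mk, ← h1, ← h2]
        rfl }

/-- The restriction of the operator `T` to a subspace `p` of its domain. -/
def restrictTo (T : E →ₗ.[ℂ] F) (p : Submodule ℂ T.domain) : E →ₗ.[ℂ] F where
  domain := p.map T.domain.subtype
  toFun := T.toFun.comp (Submodule.inclusion (Submodule.map_subtype_le T.domain p))

/-- The inclusion of the domain of a restriction into the domain of the original operator. -/
def restrictToIncl (T : E →ₗ.[ℂ] F) (p : Submodule ℂ T.domain) :
    (restrictTo T p).domain →ₗ[ℂ] T.domain :=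
  Submodule.inclusion (Submodule.map_subtype_le T.domain p)

/-- The linear maps `Γ₀, Γ₁ : dom T → G` satisfy the two conditions of a boundary triplet
`{G, Γ₀, Γ₁}` for the operator `T` (which is the adjoint of a closed densely defined symmetric
operator): `(Γ₀, Γ₁)` is onto `G × G`, and the abstract Green identity holds. -/
structure IsBoundaryTriplet (T : E →ₗ.[ℂ] E) (Γ₀ Γ₁ : T.domain →ₗ[ℂ] F) : Prop where
  surjective : ∀ a b : F, ∃ x : T.domain, Γ₀ x = a ∧ Γ₁ x = b
  green : ∀ f g : T.domain,
    inner ℂ (T f) (g : E) - inner ℂ (f : E) (T g)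
      = inner ℂ (Γ₁ f) (Γ₀ g) - inner ℂ (Γ₀ f) (Γ₁ g)

/-- A bounded operator `A` is dissipative: `Re ⟨A x, x⟩ ≤ 0` for all `x`. -/
def IsDissipative (A : E →L[ℂ] E) : Prop :=
  ∀ x : E, (inner ℂ (A x) x).re ≤ 0

/-- The operator `A` is the infinitesimal generator of a strongly continuous semigroup of
contractions `(T t)_{t ≥ 0}`: `x ∈ dom A` with `A x = y` holds exactly if
`(T h x - x) / h` tends to `y` as `h` tends to `0` from the right. -/
def GeneratesContractionSemigroup (A : E →ₗ.[ℂ] E) : Prop :=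
  ∃ T : ℝ≥0 → E →L[ℂ] E,
    T 0 = ContinuousLinearMap.id ℂ E ∧
    (∀ s t, T (s + t) = (T s).comp (T t)) ∧
    (∀ x, Continuous fun t => T t x) ∧
    (∀ t, ‖T t‖ ≤ 1) ∧
    ∀ x y, (x, y) ∈ A.graph ↔
      Tendsto (fun h : ℝ≥0 => ((h : ℝ) : ℂ)⁻¹ • (T h x - x)) (𝓝[>] 0) (𝓝 y)

theorem mem_adjoint_of_offDiag [CompleteSpace E] [CompleteSpace F]
    (B : F →ₗ.[ℂ] E) (C : E →ₗ.[ℂ] F) {x : WithLp 2 (E × F)}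
    (hx : x ∈ (offDiag B C).adjoint.domain) :
    x.fst ∈ B.adjoint.domain ∧ x.snd ∈ C.adjoint.domain := by
  rw [LinearPMap.mem_adjoint_domain_iff] at hx
  constructor
  · rw [LinearPMap.mem_adjoint_domain_iff]
    have hc : Continuous fun u : B.domain =>
        (⟨WithLp.toLp 2 ((0 : E), (u : F)), C.domain.zero_mem, u.2⟩ : (offDiag B C).domain) := by
      refine Continuous.subtype_mk ?_ _
      exact (WithLp.prod_continuous_toLp 2 E F).comp (by fun_prop)
    convert hx.comp hc using 1
    ext u
    have h0 : C ⟨0, C.domain.zero_mem⟩ = 0 := C.map_zero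
    change inner ℂ x.fst (B u)
      = inner ℂ x (WithLp.toLp 2 (B ⟨u, u.2⟩, C ⟨0, C.domain.zero_mem⟩))
    rw [h0, WithLp.prod_inner_apply]
    simp
  · rw [LinearPMap.mem_adjoint_domain_iff]
    have hc : Continuous fun u : C.domain =>
        (⟨WithLp.toLp 2 ((u : E), (0 : F)), u.2, B.domain.zero_mem⟩ : (offDiag B C).domain) := by
      refine Continuous.subtype_mk ?_ _
      exact (WithLp.prod_continuous_toLp 2 E F).comp (by fun_prop)
    convert hx.comp hc using 1
    ext u
    have h0 : B ⟨0, B.domain.zero_mem⟩ = 0 := B.map_zero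
    change inner ℂ x.snd (C u)
      = inner ℂ x (WithLp.toLp 2 (B ⟨0, B.domain.zero_mem⟩, C ⟨u, u.2⟩))
    rw [h0, WithLp.prod_inner_apply]
    simp

theorem mem_adjoint_of_I_smul [CompleteSpace E] (D : E →ₗ.[ℂ] F) {y : F}
    (hy : y ∈ (Complex.I • D).adjoint.domain) : y ∈ D.adjoint.domain := by
  rw [LinearPMap.mem_adjoint_domain_iff] at hy ⊢
  have h : Continuous fun u : D.domain =>
      (-Complex.I) * (((innerₛₗ ℂ y).comp (Complex.I • D).toFun) u) := continuous_const.mul hy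
  convert h using 1
  ext u
  change inner ℂ y (D u) = -Complex.I * inner ℂ y (Complex.I • D u)
  rw [inner_smul_right, ← mul_assoc]
  simp

end Operators

section DirectSum

variable {ι : Type*} [Fintype ι] {X : ι → Type*} [∀ j, NormedAddCommGroup (X j)]
  [∀ j, InnerProductSpace ℂ (X j)]

/-- The direct sum `⨁ D_j` of operators in the Hilbert space direct sum `⨁ X_j`. -/
def directSum (D : ∀ j, X j →ₗ.[ℂ] X j) : PiLp 2 X →ₗ.[ℂ] PiLp 2 X where
  domain :=
    { carrier := {x | ∀ j, x j ∈ (D j).domain}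
      zero_mem' := fun j => (D j).domain.zero_mem
      add_mem' := fun hx hy j => (D j).domain.add_mem (hx j) (hy j)
      smul_mem' := fun c _ hx j => (D j).domain.smul_mem c (hx j) }
  toFun :=
    { toFun := fun x => WithLp.toLp 2 fun j => D j ⟨x.1 j, x.2 j⟩
      map_add' := fun x y => by
        ext j
        exact (D j).map_add ⟨x.1 j, x.2 j⟩ ⟨y.1 j, y.2 j⟩
      map_smul' := fun c x => by
        ext j
        exact (D j).map_smul c ⟨x.1 j, x.2 j⟩ }

theorem mem_adjoint_of_directSum [∀ j, CompleteSpace (X j)] (D : ∀ j, X j →ₗ.[ℂ] X j)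
    {x : PiLp 2 X} (hx : x ∈ (directSum D).adjoint.domain) (j : ι) :
    x j ∈ (D j).adjoint.domain := by
  classical
  rw [LinearPMap.mem_adjoint_domain_iff] at hx ⊢
  have hmem : ∀ u : (D j).domain, ∀ i, (Pi.single j (u : X j) : ∀ i, X i) i ∈ (D i).domain := by
    intro u i
    rcases eq_or_ne i j with rfl | h
    · simp
    · simp [h]
  have hc : Continuous fun u : (D j).domain =>
      (⟨WithLp.toLp 2 (Pi.single j (u : X j)), hmem u⟩ : (directSum D).domain) := by
    refine Continuous.subtype_mk ?_ _
    exact (PiLp.continuous_toLp 2 X).comp ((continuous_single j).comp continuous_subtype_val)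
  convert hx.comp hc using 1
  ext u
  change inner ℂ (x j) (D j u)
    = inner ℂ x (WithLp.toLp 2 fun i =>
        D i ⟨(Pi.single j (u : X j) : ∀ i, X i) i, hmem u i⟩)
  rw [PiLp.inner_apply, Finset.sum_eq_single j]
  · congr 2
    ext
    simp
  · intro i _ h
    have h0 : (⟨(Pi.single j (u : X j) : ∀ i, X i) i, hmem u i⟩ : (D i).domain) = 0 := by
      ext
      simp [h]
    change inner ℂ (x i) (D i ⟨(Pi.single j (u : X j) : ∀ i, X i) i, hmem u i⟩) = 0
    rw [h0, LinearPMap.map_zero, inner_zero_right]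
  · simp

/-- The block diagonal operator `diag (L_v)` on the Hilbert space `G^V`. -/
noncomputable def blockDiag {G : Type*} [NormedAddCommGroup G] [InnerProductSpace ℂ G]
    (L : ι → G →L[ℂ] G) : PiLp 2 (fun _ : ι => G) →L[ℂ] PiLp 2 (fun _ : ι => G) :=
  ((PiLp.continuousLinearEquiv 2 ℂ fun _ : ι => G).symm :
      (ι → G) →L[ℂ] PiLp 2 (fun _ : ι => G)).comp
    (ContinuousLinearMap.pi fun v => (L v).comp (PiLp.proj 2 (fun _ : ι => G) v))

theorem blockDiag_apply {G : Type*} [NormedAddCommGroup G] [InnerProductSpace ℂ G]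
    (L : ι → G →L[ℂ] G) (x : PiLp 2 (fun _ : ι => G)) (v : ι) :
    blockDiag L x v = L v (x v) := rfl

end DirectSum

section Edge

variable {X G : Type*} [NormedAddCommGroup X] [InnerProductSpace ℂ X]
  [NormedAddCommGroup G] [InnerProductSpace ℂ G]

/-- The edge operator `S = [[0, iD], [iD, 0]]` in `X × X`. -/
noncomputable def edgeOp (D : X →ₗ.[ℂ] X) : WithLp 2 (X × X) →ₗ.[ℂ] WithLp 2 (X × X) :=
  offDiag (Complex.I • D) (Complex.I • D)

variable [CompleteSpace X]

/-- The first component of an element of `dom S*`, as an element of `dom D*`. -/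
noncomputable def adjFst (D : X →ₗ.[ℂ] X) :
    (edgeOp D).adjoint.domain →ₗ[ℂ] D.adjoint.domain where
  toFun x := ⟨x.1.fst, mem_adjoint_of_I_smul D (mem_adjoint_of_offDiag _ _ x.2).1⟩
  map_add' _ _ := rfl
  map_smul' _ _ := rfl

/-- The second component of an element of `dom S*`, as an element of `dom D*`. -/
noncomputable def adjSnd (D : X →ₗ.[ℂ] X) :
    (edgeOp D).adjoint.domain →ₗ[ℂ] D.adjoint.domain where
  toFun x := ⟨x.1.snd, mem_adjoint_of_I_smul D (mem_adjoint_of_offDiag _ _ x.2).2⟩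
  map_add' _ _ := rfl
  map_smul' _ _ := rfl

/-- The map `(x₀, x₁) ↦ (α x₀, β x₀)` from `dom S*` to `G × G`. -/
noncomputable def edgeΓ₀ (D : X →ₗ.[ℂ] X) (α β : D.adjoint.domain →ₗ[ℂ] G) :
    (edgeOp D).adjoint.domain →ₗ[ℂ] WithLp 2 (G × G) :=
  (WithLp.linearEquiv 2 ℂ (G × G)).symm.toLinearMap ∘ₗ
    LinearMap.prod (α ∘ₗ adjFst D) (β ∘ₗ adjFst D)

/-- The map `(x₀, x₁) ↦ (α x₁, -β x₁)` from `dom S*` to `G × G`. -/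
noncomputable def edgeΓ₁ (D : X →ₗ.[ℂ] X) (α β : D.adjoint.domain →ₗ[ℂ] G) :
    (edgeOp D).adjoint.domain →ₗ[ℂ] WithLp 2 (G × G) :=
  (WithLp.linearEquiv 2 ℂ (G × G)).symm.toLinearMap ∘ₗ
    LinearMap.prod (α ∘ₗ adjSnd D) (-(β ∘ₗ adjSnd D))

end Edge

/-- A graph with vertices `V` and edges `E` (parallel edges are allowed): the `j`-th edge has the
two distinct endpoints `ends j 0` and `ends j 1`, and every vertex is an endpoint of some edge.
The relation `(j, k) ∼ v` is `ends j k = v`. -/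
structure EdgeGraph (V E : Type*) where
  ends : E → Fin 2 → V
  ends_ne : ∀ j, ends j 0 ≠ ends j 1
  exists_end : ∀ v, ∃ p : E × Fin 2, ends p.1 p.2 = v

/-- The sign of an edge `j` at the vertex `v`: `1` if `(j, 0) ∼ v` and `-1` if `(j, 1) ∼ v`
(and `0` if `v` is not an endpoint of `j`). -/
def EdgeGraph.sgn {V E : Type*} [DecidableEq V] (𝒢 : EdgeGraph V E) (j : E) (v : V) : ℤ :=
  if 𝒢.ends j 0 = v then 1 else if 𝒢.ends j 1 = v then -1 else 0

section Network

variable {V E : Type*} [Fintype V] [DecidableEq V] [Fintype E]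
  {X : E → Type*} [∀ j, NormedAddCommGroup (X j)] [∀ j, InnerProductSpace ℂ (X j)]
  [∀ j, CompleteSpace (X j)]
  {G : Type*} [NormedAddCommGroup G] [InnerProductSpace ℂ G]

/-- The direct sum operator `S_⊕ = [[0, i ⨁ D_j], [i ⨁ D_j, 0]]` in `X_⊕ × X_⊕`. -/
noncomputable def sumOp (D : ∀ j, X j →ₗ.[ℂ] X j) :
    WithLp 2 (PiLp 2 X × PiLp 2 X) →ₗ.[ℂ] WithLp 2 (PiLp 2 X × PiLp 2 X) :=
  edgeOp (directSum D)

/-- `x ↦ x₀ʲ` for `x = (x₀, x₁) ∈ dom S_⊕*`, as an element of `dom D_j*`. -/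
noncomputable def compFst (D : ∀ j, X j →ₗ.[ℂ] X j) (j : E) :
    (sumOp D).adjoint.domain →ₗ[ℂ] (D j).adjoint.domain where
  toFun x := ⟨x.1.fst j, mem_adjoint_of_directSum D (adjFst (directSum D) x).2 j⟩
  map_add' _ _ := rfl
  map_smul' _ _ := rfl

/-- `x ↦ x₁ʲ` for `x = (x₀, x₁) ∈ dom S_⊕*`, as an element of `dom D_j*`. -/
noncomputable def compSnd (D : ∀ j, X j →ₗ.[ℂ] X j) (j : E) :
    (sumOp D).adjoint.domain →ₗ[ℂ] (D j).adjoint.domain where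
  toFun x := ⟨x.1.snd j, mem_adjoint_of_directSum D (adjSnd (directSum D) x).2 j⟩
  map_add' _ _ := rfl
  map_smul' _ _ := rfl

variable (𝒢 : EdgeGraph V E) (D : ∀ j, X j →ₗ.[ℂ] X j)
  (Γ : Fin 2 → Fin 2 → ∀ j, (D j).adjoint.domain →ₗ[ℂ] G)

/-- The elements `x` of `dom S_⊕*` which are continuous at every vertex: all the values
`Γ 0 k j x₀ʲ` with `(j, k) ∼ v` coincide. -/
noncomputable def contSubspace : Submodule ℂ (sumOp D).adjoint.domain where
  carrier := {x | ∀ j₁ k₁ j₂ k₂, 𝒢.ends j₁ k₁ = 𝒢.ends j₂ k₂ →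
    Γ 0 k₁ j₁ (compFst D j₁ x) = Γ 0 k₂ j₂ (compFst D j₂ x)}
  zero_mem' := fun j₁ k₁ j₂ k₂ _ => by simp only [map_zero]
  add_mem' := fun hx hy j₁ k₁ j₂ k₂ h => by
    simp only [map_add, hx j₁ k₁ j₂ k₂ h, hy j₁ k₁ j₂ k₂ h]
  smul_mem' := fun c _ hx j₁ k₁ j₂ k₂ h => by
    simp only [map_smul, hx j₁ k₁ j₂ k₂ h]

/-- The node values `x ↦ ((Γ₀^⊕ x)(v))_v`. A value is read off at a chosen endpoint of an edge
at `v`; for vertex-continuous `x` the choice does not matter, see `nodeValues_eq`. -/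
noncomputable def nodeValues :
    (sumOp D).adjoint.domain →ₗ[ℂ] PiLp 2 (fun _ : V => G) :=
  (WithLp.linearEquiv 2 ℂ (V → G)).symm.toLinearMap ∘ₗ
    LinearMap.pi fun v =>
      Γ 0 (𝒢.exists_end v).choose.2 (𝒢.exists_end v).choose.1 ∘ₗ
        compFst D (𝒢.exists_end v).choose.1

/-- The signed Kirchhoff sums
`x ↦ (∑_{(l, k) ∼ v} sgn (l, v) Γ 1 k l x₁ˡ)_v`. -/
noncomputable def kirchhoffSums :
    (sumOp D).adjoint.domain →ₗ[ℂ] PiLp 2 (fun _ : V => G) :=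
  (WithLp.linearEquiv 2 ℂ (V → G)).symm.toLinearMap ∘ₗ
    LinearMap.pi fun v =>
      ∑ p : E × Fin 2 with 𝒢.ends p.1 p.2 = v,
        𝒢.sgn p.1 v • (Γ 1 p.2 p.1 ∘ₗ compSnd D p.1)

theorem nodeValues_eq {x : (sumOp D).adjoint.domain} (hx : x ∈ contSubspace 𝒢 D Γ)
    (j : E) (k : Fin 2) :
    nodeValues 𝒢 D Γ x (𝒢.ends j k) = Γ 0 k j (compFst D j x) :=
  hx _ _ _ _ (𝒢.exists_end (𝒢.ends j k)).choose_spec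

/-- `S_{⊕,cnt}`: the restriction of `S_⊕*` to the vertex-continuous elements. -/
noncomputable def contOp : WithLp 2 (PiLp 2 X × PiLp 2 X) →ₗ.[ℂ] WithLp 2 (PiLp 2 X × PiLp 2 X) :=
  restrictTo (sumOp D).adjoint (contSubspace 𝒢 D Γ)

/-- `Γ₀^V : dom S_{⊕,cnt} → G^V`, the node values. -/
noncomputable def vertexΓ₀ : (contOp 𝒢 D Γ).domain →ₗ[ℂ] PiLp 2 (fun _ : V => G) :=
  nodeValues 𝒢 D Γ ∘ₗ restrictToIncl (sumOp D).adjoint (contSubspace 𝒢 D Γ)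

/-- `Γ₁^V : dom S_{⊕,cnt} → G^V`, the signed Kirchhoff sums. -/
noncomputable def vertexΓ₁ : (contOp 𝒢 D Γ).domain →ₗ[ℂ] PiLp 2 (fun _ : V => G) :=
  kirchhoffSums 𝒢 D Γ ∘ₗ restrictToIncl (sumOp D).adjoint (contSubspace 𝒢 D Γ)

/-- `S_node`: the restriction of `S_⊕*` to the vertex-continuous `x` with `Γ₁^V x = 0`. -/
noncomputable def nodeOp : WithLp 2 (PiLp 2 X × PiLp 2 X) →ₗ.[ℂ] WithLp 2 (PiLp 2 X × PiLp 2 X) :=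
  restrictTo (contOp 𝒢 D Γ) (LinearMap.ker (vertexΓ₁ 𝒢 D Γ))

/-- `S_0`: the restriction of `S_⊕*` to the vertex-continuous `x` with `Γ₀^V x = 0`. -/
noncomputable def zeroOp : WithLp 2 (PiLp 2 X × PiLp 2 X) →ₗ.[ℂ] WithLp 2 (PiLp 2 X × PiLp 2 X) :=
  restrictTo (contOp 𝒢 D Γ) (LinearMap.ker (vertexΓ₀ 𝒢 D Γ))

/-- `S_{⊕,L}`: the restriction of `S_⊕*` to the vertex-continuous `x` with
`Γ₁^V x = L Γ₀^V x`. -/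
noncomputable def loadOp (L : PiLp 2 (fun _ : V => G) →L[ℂ] PiLp 2 (fun _ : V => G)) :
    WithLp 2 (PiLp 2 X × PiLp 2 X) →ₗ.[ℂ] WithLp 2 (PiLp 2 X × PiLp 2 X) :=
  restrictTo (contOp 𝒢 D Γ)
    (LinearMap.eqLocus (vertexΓ₁ 𝒢 D Γ) (L.toLinearMap ∘ₗ vertexΓ₀ 𝒢 D Γ))

/-- The operator `-⨁ D_j*`, the largest extension of `⨁ D_j` under consideration. -/
noncomputable def maxOp : PiLp 2 X →ₗ.[ℂ] PiLp 2 X :=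
  -directSum fun j => (D j).adjoint

/-- `D_node`: the restriction of `-⨁ D_j*` to the vertex-continuous elements `x₀`. -/
noncomputable def nodeD : PiLp 2 X →ₗ.[ℂ] PiLp 2 X :=
  restrictTo (maxOp D)
    { carrier := {x | ∀ j₁ k₁ j₂ k₂, 𝒢.ends j₁ k₁ = 𝒢.ends j₂ k₂ →
        Γ 0 k₁ j₁ ⟨x.1 j₁, x.2 j₁⟩ = Γ 0 k₂ j₂ ⟨x.1 j₂, x.2 j₂⟩}
      zero_mem' := fun j₁ k₁ j₂ k₂ _ =>
        ((Γ 0 k₁ j₁).map_zero).trans ((Γ 0 k₂ j₂).map_zero).symm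
      add_mem' := fun {x y} hx hy j₁ k₁ j₂ k₂ h =>
        ((Γ 0 k₁ j₁).map_add ⟨x.1 j₁, x.2 j₁⟩ ⟨y.1 j₁, y.2 j₁⟩).trans
          ((congrArg₂ (· + ·) (hx j₁ k₁ j₂ k₂ h) (hy j₁ k₁ j₂ k₂ h)).trans
            ((Γ 0 k₂ j₂).map_add ⟨x.1 j₂, x.2 j₂⟩ ⟨y.1 j₂, y.2 j₂⟩).symm)
      smul_mem' := fun c x hx j₁ k₁ j₂ k₂ h =>
        ((Γ 0 k₁ j₁).map_smul c ⟨x.1 j₁, x.2 j₁⟩).trans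
          ((congrArg (c • ·) (hx j₁ k₁ j₂ k₂ h)).trans
            ((Γ 0 k₂ j₂).map_smul c ⟨x.1 j₂, x.2 j₂⟩).symm) }

/-- `D_0`: the restriction of `-⨁ D_j*` to the elements `x₀` with `Γ 0 k j x₀ʲ = 0` for all
edges `j` and `k = 0, 1`. -/
noncomputable def zeroD : PiLp 2 X →ₗ.[ℂ] PiLp 2 X :=
  restrictTo (maxOp D)
    { carrier := {x | ∀ j k, Γ 0 k j ⟨x.1 j, x.2 j⟩ = 0}
      zero_mem' := fun j k => (Γ 0 k j).map_zero
      add_mem' := fun {x y} hx hy j k =>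
        ((Γ 0 k j).map_add ⟨x.1 j, x.2 j⟩ ⟨y.1 j, y.2 j⟩).trans
          ((congrArg₂ (· + ·) (hx j k) (hy j k)).trans (add_zero 0))
      smul_mem' := fun c x hx j k =>
        ((Γ 0 k j).map_smul c ⟨x.1 j, x.2 j⟩).trans
          ((congrArg (c • ·) (hx j k)).trans (smul_zero c)) }

end Network

end PortHam

/-! Write `A` for the adjoint of the direct sum operator. Its boundary form `⟨Af, g⟩ - ⟨f, Ag⟩` is
the sum of the Green identities of the edges. The minus sign in the second component of each edge
map is the sign of that end of the edge, so the form equals `fluxPairing f g` minus the conjugate of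
`fluxPairing g f`, where the pairing runs over all edge ends (`IsEdgeSystem.green`). If `g` is
vertex-continuous, grouping the ends by vertex turns the pairing into the inner product of Kirchhoff
sums and node values (`fluxPairing_eq_inner`).

Values and fluxes at the ends can be prescribed independently (`exists_values`). Hence
`contSubspace` and `minSubspace` annihilate each other under the boundary form, and
`adjoint_restrictTo_of_form` turns this into adjointness of the two restrictions of `A`. This yields
(a), with the restriction to `minSubspace` as the symmetric operator.

The rest of the operator theory uses only the vertex triplet. The condition `Γ₁ x = L Γ₀ x` passes
to `L*` under adjoints, and the kernels of `Γ₀` and `Γ₁` give self-adjoint extensions. For the block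
form in (b), continuity constrains only `x₀` and the Kirchhoff condition only `x₁`, so the domain
splits; self-adjointness then forces the upper right corner to be the adjoint of the lower left one
(`eq_offDiag_of_isSelfAdjoint`).

For (c), Green's identity with `f = g` transfers dissipativity from `L` and `L*` to the extension
and its adjoint. The semigroup comes from the Lumer-Phillips theorem, proved here by Yosida
approximation: exponentials of commuting bounded dissipative operators are contractions which
converge on the domain. -/

namespace PortHam

open Filter Topology
open scoped NNReal

/-! ### Exponentials of bounded dissipative operators. -/

section BoundedDissipative

variable {H : Type*} [NormedAddCommGroup H] [InnerProductSpace ℂ H]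

theorem IsDissipative.real_smul {P : H →L[ℂ] H} (hP : IsDissipative P) {s : ℝ} (hs : 0 ≤ s) :
    IsDissipative (s • P) := by
  intro x
  rw [smul_apply, RCLike.real_smul_eq_coe_smul (K := ℂ), inner_smul_left]
  simpa using mul_nonpos_of_nonneg_of_nonpos hs (hP x)

theorem IsDissipative.add {P Q : H →L[ℂ] H} (hP : IsDissipative P) (hQ : IsDissipative Q) :
    IsDissipative (P + Q) := by
  intro x
  rw [add_apply, inner_add_left, Complex.add_re]
  exact add_nonpos (hP x) (hQ x)

variable [CompleteSpace H]

/-- The exponential of a bounded dissipative operator is a contraction. -/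
theorem IsDissipative.norm_exp_apply_le {P : H →L[ℂ] H} (hP : IsDissipative P) (x : H) :
    ‖NormedSpace.exp P x‖ ≤ ‖x‖ := by
  have hderiv : ∀ s : ℝ, HasDerivAt (fun s : ℝ => NormedSpace.exp (s • P) x)
      (P (NormedSpace.exp (s • P) x)) s := by
    intro s
    have h := ((ContinuousLinearMap.apply ℂ H x).restrictScalars ℝ).hasFDerivAt.comp_hasDerivAt s
      (hasDerivAt_exp_smul_const' (𝕂 := ℝ) P s)
    exact h
  -- By dissipativity the squared norm of the orbit is nonincreasing; comparing the times 0 and 1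
  -- gives the claim.
  have hsq : ∀ s : ℝ, HasDerivAt (fun s : ℝ => ‖NormedSpace.exp (s • P) x‖ ^ 2)
      (2 * (inner ℂ (P (NormedSpace.exp (s • P) x)) (NormedSpace.exp (s • P) x)).re) s := by
    intro s
    let : InnerProductSpace ℝ H := InnerProductSpace.complexToReal
    have h := (hderiv s).norm_sq
    convert h using 1
    rw [real_inner_comm]
    rfl
  have hanti : Antitone fun s : ℝ => ‖NormedSpace.exp (s • P) x‖ ^ 2 := by
    apply antitone_of_deriv_nonpos
    · exact fun s => (hsq s).differentiableAt
    · intro s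
      rw [(hsq s).deriv]
      have := hP (NormedSpace.exp (s • P) x)
      linarith
  have h01 := hanti (zero_le_one : (0 : ℝ) ≤ 1)
  simp only [one_smul, zero_smul, NormedSpace.exp_zero] at h01
  exact le_of_sq_le_sq h01 (norm_nonneg _)

/-- Exponentials of commuting bounded dissipative operators differ at most as the operators do. -/
theorem IsDissipative.norm_exp_sub_exp_apply_le {P Q : H →L[ℂ] H} (hP : IsDissipative P)
    (hQ : IsDissipative Q) (hPQ : Commute P Q) (x : H) :
    ‖NormedSpace.exp P x - NormedSpace.exp Q x‖ ≤ ‖P x - Q x‖ := by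
  -- This path joins `exp Q` to `exp P`. Its exponents are convex combinations of dissipative
  -- operators, so its derivative is a contraction applied to `P x - Q x`, and the mean value
  -- inequality finishes.
  have hexp : ∀ s : ℝ, NormedSpace.exp (s • (P - Q)) * NormedSpace.exp Q
      = NormedSpace.exp (s • P + (1 - s) • Q) := by
    intro s
    let : NormedAlgebra ℚ (H →L[ℂ] H) := NormedAlgebra.restrictScalars ℚ ℝ _
    rw [← NormedSpace.exp_add_of_commute]
    · congr 1
      module
    · exact (hPQ.sub_left (Commute.refl Q)).smul_left s
  have hderiv : ∀ s : ℝ, HasDerivAt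
      (fun s : ℝ => (NormedSpace.exp (s • (P - Q)) * NormedSpace.exp Q) x)
      (NormedSpace.exp (s • P + (1 - s) • Q) (P x - Q x)) s := by
    intro s
    have h := ((ContinuousLinearMap.apply ℂ H (NormedSpace.exp Q x)).restrictScalars ℝ).hasFDerivAt.comp_hasDerivAt s
      (hasDerivAt_exp_smul_const (𝕂 := ℝ) (P - Q) s)
    have hc : (P - Q) * NormedSpace.exp Q = NormedSpace.exp Q * (P - Q) :=
      ((hPQ.sub_left (Commute.refl Q)).exp_right).eq
    rw [← hexp]
    have he : (NormedSpace.exp (s • (P - Q)) * NormedSpace.exp Q) (P x - Q x)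
        = (NormedSpace.exp (s • (P - Q)) * (P - Q)) (NormedSpace.exp Q x) := by
      change (NormedSpace.exp (s • (P - Q)) * (NormedSpace.exp Q * (P - Q))) x
        = (NormedSpace.exp (s • (P - Q)) * ((P - Q) * NormedSpace.exp Q)) x
      rw [hc]
    rw [he]
    exact h
  have hmv := norm_image_sub_le_of_norm_deriv_le_segment_01'
    (f := fun s : ℝ => (NormedSpace.exp (s • (P - Q)) * NormedSpace.exp Q) x)
    (C := ‖P x - Q x‖) (fun s _ => (hderiv s).hasDerivWithinAt) (fun s hs =>
      ((hP.real_smul hs.1).add (hQ.real_smul (sub_nonneg.2 hs.2.le))).norm_exp_apply_le _)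
  simp only [hexp] at hmv
  simpa only [one_smul, sub_self, zero_smul, add_zero, sub_zero, zero_add] using hmv

/-- The first order Taylor remainder of the orbit of a bounded dissipative operator. -/
theorem IsDissipative.norm_exp_smul_apply_sub_sub_le {P : H →L[ℂ] H} (hP : IsDissipative P)
    (x y z : H) {h : ℝ} (hh : 0 ≤ h) :
    ‖NormedSpace.exp (h • P) x - x - h • y‖
      ≤ h * (‖P x - y‖ + 2 * ‖y - z‖ + h * ‖P z‖) := by
  have hderiv : ∀ s : ℝ, HasDerivAt (fun s : ℝ => NormedSpace.exp (s • P) x - s • y)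
      (NormedSpace.exp (s • P) (P x) - y) s := by
    intro s
    have h := ((ContinuousLinearMap.apply ℂ H x).restrictScalars ℝ).hasFDerivAt.comp_hasDerivAt s
      (hasDerivAt_exp_smul_const (𝕂 := ℝ) P s)
    have h2 := (hasDerivAt_id s).smul_const y
    rw [one_smul] at h2
    exact h.sub h2
  have hbound : ∀ s ∈ Set.Ico 0 h, ‖NormedSpace.exp (s • P) (P x) - y‖
      ≤ ‖P x - y‖ + 2 * ‖y - z‖ + h * ‖P z‖ := by
    intro s hs
    have hsP := hP.real_smul hs.1
    have h1 := hsP.norm_exp_apply_le (P x - y)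
    have h2 := hsP.norm_exp_apply_le (y - z)
    have h3 := hsP.norm_exp_sub_exp_apply_le (Q := 0) (fun w => by simp) (Commute.zero_right _) z
    rw [NormedSpace.exp_zero, zero_apply, sub_zero,
      smul_apply, norm_smul, Real.norm_of_nonneg hs.1] at h3
    have h4 : s * ‖P z‖ ≤ h * ‖P z‖ := mul_le_mul_of_nonneg_right hs.2.le (norm_nonneg _)
    -- `P y` need not stay bounded along the approximations used later, so `y` is replaced by a
    -- nearby `z`. The replacement costs `2 * ‖y - z‖`, and the orbit of `z` moves by at most `s *
    -- ‖P z‖`.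
    have e : NormedSpace.exp (s • P) (P x) - y
        = NormedSpace.exp (s • P) (P x - y) + (NormedSpace.exp (s • P) (y - z) - (y - z))
          + (NormedSpace.exp (s • P) z - z) := by
      simp only [map_sub]
      abel
    rw [e]
    have h5 := norm_add₃_le (a := NormedSpace.exp (s • P) (P x - y))
      (b := NormedSpace.exp (s • P) (y - z) - (y - z)) (c := NormedSpace.exp (s • P) z - z)
    have h6 := norm_sub_le (NormedSpace.exp (s • P) (y - z)) (y - z)
    have h7 : ‖NormedSpace.exp (s • P) z - z‖ ≤ s * ‖P z‖ := h3
    linarith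
  have hmv := norm_image_sub_le_of_norm_deriv_le_segment'
    (fun s _ => (hderiv s).hasDerivWithinAt) hbound h ⟨hh, le_rfl⟩
  simp only [zero_smul, NormedSpace.exp_zero, sub_zero] at hmv
  rw [mul_comm, sub_right_comm]
  exact hmv

end BoundedDissipative

/-! ### Contraction semigroups as strong limits of exponentials. -/

section Generation

variable {H : Type*} [NormedAddCommGroup H] [InnerProductSpace ℂ H]

/-- A sequence of contractions which converges on a dense set converges everywhere. -/
theorem cauchySeq_apply_of_dense {E : ℕ → H →L[ℂ] H} (hE : ∀ n x, ‖E n x‖ ≤ ‖x‖) {s : Set H}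
    (hs : Dense s) (h : ∀ x ∈ s, CauchySeq fun n => E n x) (x : H) :
    CauchySeq fun n => E n x := by
  rw [Metric.cauchySeq_iff]
  intro ε hε
  obtain ⟨z, hz, hxz⟩ := hs.exists_dist_lt x (show 0 < ε / 4 by positivity)
  obtain ⟨N, hN⟩ := Metric.cauchySeq_iff.1 (h z hz) (ε / 4) (by positivity)
  refine ⟨N, fun m hm n hn => ?_⟩
  have h1 := hN m hm n hn
  rw [dist_eq_norm] at h1 hxz ⊢
  have h2 := hE m (x - z)
  have h3 := hE n (x - z)
  have e : E m x - E n x = E m (x - z) + (E m z - E n z) - E n (x - z) := by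
    simp only [map_sub]
    abel
  rw [e]
  have h4 := norm_sub_le (E m (x - z) + (E m z - E n z)) (E n (x - z))
  have h5 := norm_add_le (E m (x - z)) (E m z - E n z)
  linarith

variable [CompleteSpace H]

/-- A densely defined operator `A` with `1 - A` surjective which is the strong limit, on its
domain, of commuting bounded dissipative operators generates a contraction semigroup. -/
theorem generatesContractionSemigroup_of_tendsto {A : H →ₗ.[ℂ] H}
    (hdense : Dense (A.domain : Set H)) {P : ℕ → H →L[ℂ] H} (hP : ∀ n, IsDissipative (P n))
    (hcomm : ∀ m n, Commute (P m) (P n))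
    (hlim : ∀ x y, (x, y) ∈ A.graph → Tendsto (fun n => P n x) atTop (𝓝 y))
    (hsurj : ∀ z, ∃ x, (x, x - z) ∈ A.graph) : GeneratesContractionSemigroup A := by
  let S : ℝ≥0 → ℕ → H →L[ℂ] H := fun t n => NormedSpace.exp ((t : ℝ) • P n)
  have hS : ∀ t n x, ‖S t n x‖ ≤ ‖x‖ := fun t n x =>
    ((hP n).real_smul t.2).norm_exp_apply_le x
  have hcauchy : ∀ t x, CauchySeq fun n => S t n x := by
    intro t
    refine cauchySeq_apply_of_dense (hS t) hdense fun x hx => ?_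
    -- On the domain, the exponentials at time `t` differ by at most `t` times the difference of `P
    -- m x` and `P n x`, and the latter sequence converges.
    have hc := (hlim x _ (A.mem_graph ⟨x, hx⟩)).const_smul (t : ℝ) |>.cauchySeq
    rw [Metric.cauchySeq_iff] at hc ⊢
    intro ε hε
    obtain ⟨N, hN⟩ := hc ε hε
    refine ⟨N, fun m hm n hn => lt_of_le_of_lt ?_ (hN m hm n hn)⟩
    rw [dist_eq_norm, dist_eq_norm]
    exact ((hP m).real_smul t.2).norm_exp_sub_exp_apply_le ((hP n).real_smul t.2)
      (((hcomm m n).smul_left _).smul_right _) x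
  choose T₀ hT₀ using fun t x => cauchySeq_tendsto_of_complete (hcauchy t x)
  have hT₀le : ∀ t x, ‖T₀ t x‖ ≤ ‖x‖ := fun t x =>
    le_of_tendsto (hT₀ t x).norm (Eventually.of_forall fun n => hS t n x)
  let T : ℝ≥0 → H →L[ℂ] H := fun t => LinearMap.mkContinuous
    { toFun := T₀ t
      map_add' := fun x y => by
        refine tendsto_nhds_unique (hT₀ t (x + y)) ?_
        simpa only [map_add] using (hT₀ t x).add (hT₀ t y)
      map_smul' := fun c x => by
        refine tendsto_nhds_unique (hT₀ t (c • x)) ?_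
        simpa only [map_smul, RingHom.id_apply] using (hT₀ t x).const_smul c }
    1 fun x => by simpa using hT₀le t x
  have hT : ∀ t x, Tendsto (fun n => S t n x) atTop (𝓝 (T t x)) := hT₀
  have hTle : ∀ t x, ‖T t x‖ ≤ ‖x‖ := hT₀le
  have hT0 : T 0 = ContinuousLinearMap.id ℂ H := by
    ext x
    refine tendsto_nhds_unique (hT 0 x) ?_
    simp [S, NormedSpace.exp_zero]
  have hTadd : ∀ s t, T (s + t) = (T s).comp (T t) := by
    intro s t
    ext x
    refine tendsto_nhds_unique (hT (s + t) x) ?_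
    have hadd : ∀ n, S (s + t) n x = S s n (S t n x - T t x) + S s n (T t x) := by
      intro n
      let : NormedAlgebra ℚ (H →L[ℂ] H) := NormedAlgebra.restrictScalars ℚ ℝ _
      rw [map_sub, sub_add_cancel]
      change NormedSpace.exp (((s + t : ℝ≥0) : ℝ) • P n) x = _
      rw [NNReal.coe_add, add_smul, NormedSpace.exp_add_of_commute
        (((Commute.refl (P n)).smul_left _).smul_right _)]
      rfl
    simp only [hadd]
    have h0 : Tendsto (fun n => S s n (S t n x - T t x)) atTop (𝓝 0) := by
      refine squeeze_zero_norm (fun n => hS s n _) ?_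
      have := (tendsto_iff_norm_sub_tendsto_zero).1 (hT t x)
      exact this
    simpa using h0.add (hT s (T t x))
  have hlip : ∀ x y, (x, y) ∈ A.graph → ∀ s t : ℝ≥0,
      ‖T s x - T t x‖ ≤ ‖((s : ℝ) - t) • y‖ := by
    intro x y hxy s t
    refine le_of_tendsto_of_tendsto ((hT s x).sub (hT t x)).norm
      ((hlim x y hxy).const_smul ((s : ℝ) - t)).norm (Eventually.of_forall fun n => ?_)
    have := ((hP n).real_smul s.2).norm_exp_sub_exp_apply_le ((hP n).real_smul t.2)
      (((Commute.refl (P n)).smul_left _).smul_right _) x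
    beta_reduce
    rw [sub_smul]
    exact this
  have hcont : ∀ x, Continuous fun t => T t x := by
    intro x
    refine continuous_iff_continuousAt.2 fun t => ?_
    rw [Metric.continuousAt_iff]
    intro ε hε
    obtain ⟨z, hz, hxz⟩ := hdense.exists_dist_lt x (show 0 < ε / 4 by positivity)
    have hl := hlip z _ (A.mem_graph ⟨z, hz⟩)
    set y := A ⟨z, hz⟩
    -- Adding 1 keeps the denominator positive when `y = 0`.
    refine ⟨ε / (4 * (‖y‖ + 1)), by positivity, fun s hst => ?_⟩
    have h1 := hl s t
    rw [norm_smul] at h1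
    have h2 : ‖(s : ℝ) - t‖ * ‖y‖ ≤ ε / 4 := by
      have h3 : ‖(s : ℝ) - t‖ ≤ ε / (4 * (‖y‖ + 1)) := hst.le
      calc ‖(s : ℝ) - t‖ * ‖y‖ ≤ ε / (4 * (‖y‖ + 1)) * (‖y‖ + 1) := by
            gcongr
            linarith
        _ = ε / 4 := by field_simp
    rw [dist_eq_norm] at hxz ⊢
    have h4 := hTle s (x - z)
    have h5 := hTle t (x - z)
    have e : T s x - T t x = T s (x - z) + (T s z - T t z) - T t (x - z) := by
      simp only [map_sub]
      abel
    rw [e]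
    have h6 := norm_sub_le (T s (x - z) + (T s z - T t z)) (T t (x - z))
    have h7 := norm_add_le (T s (x - z)) (T s z - T t z)
    linarith
  have htaylor : ∀ x y z w, (x, y) ∈ A.graph → (z, w) ∈ A.graph → ∀ h : ℝ≥0,
      ‖T h x - x - (h : ℝ) • y‖ ≤ h * (2 * ‖y - z‖ + h * ‖w‖) := by
    intro x y z w hxy hzw h
    have hl := ((((tendsto_iff_norm_sub_tendsto_zero).1 (hlim x y hxy)).add_const
      (2 * ‖y - z‖)).add ((hlim z w hzw).norm.const_mul (h : ℝ))).const_mul (h : ℝ)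
    rw [zero_add] at hl
    exact le_of_tendsto_of_tendsto (((hT h x).sub_const x).sub_const ((h : ℝ) • y)).norm hl
      (Eventually.of_forall fun n => (hP n).norm_exp_smul_apply_sub_sub_le x y z h.2)
  have hderiv : ∀ x y, (x, y) ∈ A.graph →
      Tendsto (fun h : ℝ≥0 => ((h : ℝ) : ℂ)⁻¹ • (T h x - x)) (𝓝[>] 0) (𝓝 y) := by
    intro x y hxy
    rw [Metric.tendsto_nhds]
    intro ε hε
    -- `y = A x` may lie outside the domain; the Taylor bound needs a domain element `z` close to
    -- it.
    obtain ⟨z, hz, hyz⟩ := hdense.exists_dist_lt y (show 0 < ε / 4 by positivity)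
    have ht := htaylor x y z _ hxy (A.mem_graph ⟨z, hz⟩)
    set w := A ⟨z, hz⟩
    have hsmall : ∀ᶠ h : ℝ≥0 in 𝓝[>] 0, (h : ℝ) * ‖w‖ < ε / 4 := by
      have hc : Continuous fun h : ℝ≥0 => (h : ℝ) * ‖w‖ := by fun_prop
      have hc0 := hc.tendsto 0
      simp only [NNReal.coe_zero, zero_mul] at hc0
      exact (hc0.mono_left nhdsWithin_le_nhds).eventually_lt_const (by positivity)
    filter_upwards [hsmall, self_mem_nhdsWithin] with h hw hpos
    have hpos' : (0 : ℝ) < h := hpos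
    have hne : ((h : ℝ) : ℂ) ≠ 0 := by exact_mod_cast hpos'.ne'
    have e : ((h : ℝ) : ℂ)⁻¹ • (T h x - x) - y
        = ((h : ℝ) : ℂ)⁻¹ • (T h x - x - (h : ℝ) • y) := by
      rw [smul_sub (((h : ℝ) : ℂ)⁻¹) (T h x - x), RCLike.real_smul_eq_coe_smul (K := ℂ) (h : ℝ) y,
        smul_smul]
      congr 1
      change y = (((h : ℝ) : ℂ)⁻¹ * ((h : ℝ) : ℂ)) • y
      rw [inv_mul_cancel₀ hne, one_smul]
    rw [dist_eq_norm] at hyz ⊢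
    rw [e, norm_smul, norm_inv, Complex.norm_real, Real.norm_of_nonneg hpos'.le,
      inv_mul_lt_iff₀ hpos']
    refine (ht h).trans_lt (mul_lt_mul_of_pos_left ?_ hpos')
    linarith
  refine ⟨T, hT0, hTadd, hcont, fun t => ?_, fun x y => ⟨hderiv x y, fun hxy => ?_⟩⟩
  · exact ContinuousLinearMap.opNorm_le_bound _ zero_le_one fun x => by simpa using hTle t x
  -- The generator of `T` has no more elements than `A`: choose `x'` in the domain with `x' - A x' =
  -- x - y`. The difference quotients at `x - x'` then tend to `x - x'` itself, while contractivity
  -- makes the real part of their inner product with `x - x'` nonpositive. Hence `x = x'`.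
  · obtain ⟨x', hx'⟩ := hsurj (x - y)
    have hsub : Tendsto (fun h : ℝ≥0 => ((h : ℝ) : ℂ)⁻¹ • (T h (x - x') - (x - x'))) (𝓝[>] 0)
        (𝓝 (x - x')) := by
      have := hxy.sub (hderiv _ _ hx')
      rw [show y - (x' - (x - y)) = x - x' by abel] at this
      refine this.congr fun h => ?_
      rw [← smul_sub, map_sub]
      congr 1
      abel
    have hre : (inner ℂ (x - x') (x - x')).re ≤ 0 := by
      have hc : Tendsto (fun h : ℝ≥0 =>
          (inner ℂ (((h : ℝ) : ℂ)⁻¹ • (T h (x - x') - (x - x'))) (x - x')).re) (𝓝[>] 0)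
          (𝓝 (inner ℂ (x - x') (x - x')).re) :=
        (Complex.continuous_re.tendsto _).comp (hsub.inner tendsto_const_nhds)
      have hne : (𝓝[>] (0 : ℝ≥0)).NeBot := inferInstance
      refine le_of_tendsto hc (Eventually.of_forall fun h => ?_)
      rw [inner_smul_left, ← Complex.ofReal_inv, Complex.conj_ofReal, Complex.re_ofReal_mul,
        inner_sub_left, Complex.sub_re]
      refine mul_nonpos_of_nonneg_of_nonpos (inv_nonneg.2 h.2) ?_
      have h1 := (Complex.re_le_norm _).trans
        (norm_inner_le_norm (𝕜 := ℂ) (T h (x - x')) (x - x'))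
      have h2 : (inner ℂ (x - x') (x - x')).re = ‖x - x'‖ * ‖x - x'‖ :=
        inner_self_eq_norm_mul_norm (𝕜 := ℂ) _
      have h3 := mul_le_mul_of_nonneg_right (hTle h (x - x')) (norm_nonneg (x - x'))
      linarith
    have hxx' : x - x' = 0 := (re_inner_self_nonpos (𝕜 := ℂ)).1 hre
    obtain rfl := sub_eq_zero.1 hxx'
    simpa using hx'

end Generation

/-! ### Resolvents, Yosida approximation and the Lumer-Phillips theorem. -/

section Resolvent

variable {H : Type*} [NormedAddCommGroup H] [InnerProductSpace ℂ H]

/-- The lower bound `l ‖x‖ ≤ ‖(l - A) x‖` for dissipative operators. -/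
theorem norm_le_norm_smul_sub {l : ℝ} {x y : H} (h : (inner ℂ y x).re ≤ 0) :
    l * ‖x‖ ≤ ‖(l : ℂ) • x - y‖ := by
  rcases (norm_nonneg x).eq_or_lt with h0 | h0
  · rw [← h0, mul_zero]
    exact norm_nonneg _
  · refine le_of_mul_le_mul_right ?_ h0
    have h1 := (Complex.re_le_norm _).trans (norm_inner_le_norm (𝕜 := ℂ) ((l : ℂ) • x - y) x)
    have h2 : (inner ℂ x x).re = ‖x‖ * ‖x‖ := inner_self_eq_norm_mul_norm (𝕜 := ℂ) _
    rw [inner_sub_left, Complex.sub_re, inner_smul_left, Complex.conj_ofReal,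
      Complex.re_ofReal_mul, h2] at h1
    linarith

variable {A : H →ₗ.[ℂ] H}

/-- The resolvent of a dissipative operator. -/
theorem exists_resolvent (hA : ∀ x y, (x, y) ∈ A.graph → (inner ℂ y x).re ≤ 0) {l : ℝ} (hl : 0 < l)
    (hsurj : ∀ z, ∃ x y, (x, y) ∈ A.graph ∧ (l : ℂ) • x - y = z) :
    ∃ R : H →L[ℂ] H, (∀ z, (R z, (l : ℂ) • R z - z) ∈ A.graph) ∧
      (∀ x y, (x, y) ∈ A.graph → R ((l : ℂ) • x - y) = x) ∧ ∀ z, l * ‖R z‖ ≤ ‖z‖ := by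
  -- Uniqueness of the solution, from the lower bound, is also what makes the chosen solution map
  -- linear.
  have huniq : ∀ x y x' y', (x, y) ∈ A.graph → (x', y') ∈ A.graph →
      (l : ℂ) • x - y = (l : ℂ) • x' - y' → x = x' := by
    intro x y x' y' h h' heq
    have h1 := norm_le_norm_smul_sub (l := l) (hA _ _ (A.graph.sub_mem h h'))
    have h2 : (l : ℂ) • (x - x') - (y - y') = 0 := by
      rw [smul_sub, sub_sub_sub_comm, heq, sub_self]
    change l * ‖x - x'‖ ≤ ‖(l : ℂ) • (x - x') - (y - y')‖ at h1
    rw [h2, norm_zero] at h1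
    exact sub_eq_zero.1 (norm_eq_zero.1
      (le_antisymm (nonpos_of_mul_nonpos_right h1 hl) (norm_nonneg _)))
  choose R₀ B hg heq using hsurj
  have hinv : ∀ x y, (x, y) ∈ A.graph → R₀ ((l : ℂ) • x - y) = x := fun x y h =>
    huniq _ _ _ _ (hg _) h (heq _)
  have hB : ∀ z, B z = (l : ℂ) • R₀ z - z := fun z => by
    nth_rw 3 [← heq z]
    abel
  have hbound : ∀ z, l * ‖R₀ z‖ ≤ ‖z‖ := fun z => by
    have := norm_le_norm_smul_sub (l := l) (hA _ _ (hg z))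
    rwa [heq] at this
  refine ⟨LinearMap.mkContinuous
    { toFun := R₀
      map_add' := fun z w => huniq _ _ _ _ (hg _) (A.graph.add_mem (hg z) (hg w)) ?_
      map_smul' := fun c z => huniq _ _ _ _ (hg _) (A.graph.smul_mem c (hg z)) ?_ } l⁻¹ ?_,
    fun z => ?_, hinv, hbound⟩
  · rw [heq]
    change _ = (l : ℂ) • (R₀ z + R₀ w) - (B z + B w)
    rw [smul_add, add_sub_add_comm, heq, heq]
  · rw [heq]
    change _ = (l : ℂ) • (c • R₀ z) - c • B z
    rw [smul_comm, ← smul_sub, heq]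
  · intro z
    rw [le_inv_mul_iff₀ hl]
    exact hbound z
  · change (R₀ z, (l : ℂ) • R₀ z - z) ∈ A.graph
    rw [← hB]
    exact hg z

variable [CompleteSpace H]

theorem mem_graph_adjoint_iff {E F : Type*} [NormedAddCommGroup E] [InnerProductSpace ℂ E]
    [CompleteSpace E] [NormedAddCommGroup F] [InnerProductSpace ℂ F] {T : E →ₗ.[ℂ] F}
    (hT : Dense (T.domain : Set E)) {x : F} {y : E} :
    (x, y) ∈ T.adjoint.graph ↔ ∀ u v, (u, v) ∈ T.graph → inner ℂ v x = inner ℂ u y := by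
  rw [LinearPMap.adjoint_graph_eq_graph_adjoint hT, Submodule.mem_adjoint_iff]
  simp only [sub_eq_zero]

/-- If `A` is closed, and `A` and `A*` are dissipative, then `l - A` is onto for `l > 0`. -/
theorem exists_smul_sub_eq (hdense : Dense (A.domain : Set H)) (hclosed : A.IsClosed)
    (hA : ∀ x y, (x, y) ∈ A.graph → (inner ℂ y x).re ≤ 0)
    (hA' : ∀ x y, (x, y) ∈ A.adjoint.graph → (inner ℂ y x).re ≤ 0) {l : ℝ} (hl : 0 < l) (z : H) :
    ∃ x y, (x, y) ∈ A.graph ∧ (l : ℂ) • x - y = z := by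
  -- On the graph, which is complete because `A` is closed, `l - A` becomes a bounded, everywhere
  -- defined map.
  let F : A.graph →L[ℂ] H :=
    ((l : ℂ) • ContinuousLinearMap.fst ℂ H H - ContinuousLinearMap.snd ℂ H H).comp A.graph.subtypeL
  have hF : ∀ p : A.graph, F p = (l : ℂ) • p.1.1 - p.1.2 := fun _ => rfl
  have hcomplete : CompleteSpace A.graph := IsClosed.completeSpace_coe (hs := hclosed)
  -- The first coordinate is at most `l⁻¹ * ‖F p‖` and the second at most `2 * ‖F p‖`; the sum of
  -- the two constants bounds the maximum norm.
  have hanti : AntilipschitzWith (Real.toNNReal (l⁻¹ + 2)) F := by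
    refine AddMonoidHomClass.antilipschitz_of_bound F fun p => ?_
    rw [Real.coe_toNNReal _ (by positivity)]
    have h1 : l * ‖p.1.1‖ ≤ ‖F p‖ := norm_le_norm_smul_sub (hA p.1.1 p.1.2 p.2)
    have h2 : ‖p.1.1‖ ≤ l⁻¹ * ‖F p‖ := by
      rwa [le_inv_mul_iff₀ hl]
    have h3 : ‖p.1.2‖ ≤ 2 * ‖F p‖ := by
      have h4 : p.1.2 = (l : ℂ) • p.1.1 - F p := by
        rw [hF]
        abel
      have h5 := norm_sub_le ((l : ℂ) • p.1.1) (F p)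
      rw [← h4, norm_smul, Complex.norm_real, Real.norm_of_nonneg hl.le] at h5
      linarith
    have h6 := norm_nonneg (F p)
    have h7 : 0 ≤ l⁻¹ * ‖F p‖ := by positivity
    refine max_le ?_ ?_
    · change ‖p.1.1‖ ≤ _
      linarith
    · change ‖p.1.2‖ ≤ _
      linarith
  have hrange : IsClosed (F.range : Set H) := by
    rw [LinearMap.coe_range]
    exact hanti.isClosed_range F.uniformContinuous
  have horth : F.rangeᗮ = ⊥ := by
    rw [Submodule.eq_bot_iff]
    intro w hw
    -- A vector orthogonal to the range is an eigenvector of `A*` for `l > 0` or zero, and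
    -- dissipativity of `A*` excludes the former.
    have hg : (w, (l : ℂ) • w) ∈ A.adjoint.graph := by
      rw [mem_graph_adjoint_iff hdense]
      intro u v huv
      have h := hw (F ⟨(u, v), huv⟩) ⟨_, rfl⟩
      rw [hF, inner_sub_left, sub_eq_zero, inner_smul_left, Complex.conj_ofReal] at h
      rw [inner_smul_right]
      exact h.symm
    have h := hA' _ _ hg
    rw [inner_smul_left, Complex.conj_ofReal, Complex.re_ofReal_mul] at h
    exact (re_inner_self_nonpos (𝕜 := ℂ)).1 (nonpos_of_mul_nonpos_right h hl)
  have htop : F.range = ⊤ := by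
    rw [← hrange.submodule_topologicalClosure_eq, Submodule.topologicalClosure_eq_top_iff, horth]
  obtain ⟨p, hp⟩ := (LinearMap.range_eq_top.1 htop) z
  exact ⟨p.1.1, p.1.2, p.2, hp⟩

/-- **Lumer-Phillips theorem** in Hilbert spaces: a closed densely defined operator which is
dissipative together with its adjoint generates a contraction semigroup. -/
theorem generatesContractionSemigroup_of_dissipative (hdense : Dense (A.domain : Set H))
    (hclosed : A.IsClosed) (hA : ∀ x y, (x, y) ∈ A.graph → (inner ℂ y x).re ≤ 0)
    (hA' : ∀ x y, (x, y) ∈ A.adjoint.graph → (inner ℂ y x).re ≤ 0) :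
    GeneratesContractionSemigroup A := by
  have hsurj : ∀ {l : ℝ}, 0 < l → ∀ z, ∃ x y, (x, y) ∈ A.graph ∧ (l : ℂ) • x - y = z :=
    fun hl => exists_smul_sub_eq hdense hclosed hA hA' hl
  let l : ℕ → ℝ := fun n => n + 1
  have hl : ∀ n, 0 < l n := fun n => by positivity
  choose R hRg hRinv hRle using fun n => exists_resolvent hA (hl n) (hsurj (hl n))
  have hres : ∀ m n z, R m z - R n z = ((l n : ℂ) - l m) • R m (R n z) := by
    intro m n z
    have h := hRinv m _ _ (hRg n z)
    have e : (l m : ℂ) • R n z - ((l n : ℂ) • R n z - z) = z - ((l n : ℂ) - l m) • R n z := by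
      module
    rw [e, map_sub, map_smul] at h
    rw [sub_eq_iff_eq_add] at h
    rw [h, add_sub_cancel_left]
  have hRcomm : ∀ m n, Commute (R m) (R n) := by
    intro m n
    rcases eq_or_ne m n with rfl | hmn
    · exact Commute.refl _
    · have hne : (l n : ℂ) - l m ≠ 0 := by
        rw [sub_ne_zero]
        intro h
        have h1 : l n = l m := by exact_mod_cast h
        have h2 : (n : ℝ) = m := by linarith
        exact hmn (by exact_mod_cast h2.symm)
      ext z
      -- Exchanging `m` and `n` in the resolvent identity changes both sides by a sign; the nonzero
      -- scalar then cancels.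
      change R m (R n z) = R n (R m z)
      have h1 := hres m n z
      have h2 := hres n m z
      rw [← neg_sub (l n : ℂ), neg_smul, ← neg_sub (R m z), neg_inj] at h2
      exact smul_right_injective H hne (h1.symm.trans h2)
  -- The Yosida approximation `l A R = l (l R - 1)`, which equals `l R A` on the domain.
  let P : ℕ → H →L[ℂ] H := fun n => (l n : ℂ) • ((l n : ℂ) • R n - 1)
  have hPapply : ∀ n z, P n z = (l n : ℂ) • ((l n : ℂ) • R n z - z) := fun _ _ => rfl
  have hPgraph : ∀ n x y, (x, y) ∈ A.graph → P n x = (l n : ℂ) • R n y := by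
    intro n x y hxy
    rw [hPapply]
    congr 1
    nth_rw 2 [← hRinv n x y hxy]
    rw [map_sub, map_smul]
    abel
  have hcontr : ∀ n z, ‖(l n : ℂ) • R n z‖ ≤ ‖z‖ := fun n z => by
    rw [norm_smul, Complex.norm_real, Real.norm_of_nonneg (hl n).le]
    exact hRle n z
  have hlinv : Tendsto (fun n => (l n)⁻¹) atTop (𝓝 0) := by
    have := tendsto_one_div_add_atTop_nhds_zero_nat (𝕜 := ℝ)
    simpa only [one_div] using this
  have happrox : ∀ z, Tendsto (fun n => (l n : ℂ) • R n z) atTop (𝓝 z) := by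
    intro z
    rw [Metric.tendsto_atTop]
    intro ε hε
    obtain ⟨x, hx, hzx⟩ := hdense.exists_dist_lt z (show 0 < ε / 3 by positivity)
    have hxy := A.mem_graph ⟨x, hx⟩
    set y := A ⟨x, hx⟩
    have hsm : Tendsto (fun n => (l n)⁻¹ * ‖y‖) atTop (𝓝 0) := by
      simpa using hlinv.mul_const ‖y‖
    obtain ⟨N, hN⟩ := eventually_atTop.1 (hsm.eventually_lt_const (show 0 < ε / 3 by positivity))
    refine ⟨N, fun n hn => ?_⟩
    -- On the domain `l R x - x = R A x`, which is of order `1 / l`; the uniform bound on `l R`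
    -- extends the convergence to all vectors.
    have h1 : ‖(l n : ℂ) • R n x - x‖ ≤ (l n)⁻¹ * ‖y‖ := by
      have h2 : (l n : ℂ) • R n x - x = R n y := by
        nth_rw 2 [← hRinv n x y hxy]
        rw [map_sub, map_smul]
        abel
      rw [h2, le_inv_mul_iff₀ (hl n)]
      exact hRle n y
    have h3 := hcontr n (z - x)
    rw [dist_eq_norm] at hzx ⊢
    have e : (l n : ℂ) • R n z - z
        = (l n : ℂ) • R n (z - x) + ((l n : ℂ) • R n x - x) - (z - x) := by
      simp only [map_sub, smul_sub]
      abel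
    rw [e]
    have h4 := norm_sub_le ((l n : ℂ) • R n (z - x) + ((l n : ℂ) • R n x - x)) (z - x)
    have h5 := norm_add_le ((l n : ℂ) • R n (z - x)) ((l n : ℂ) • R n x - x)
    have h6 := hN n hn
    linarith
  refine generatesContractionSemigroup_of_tendsto hdense (P := P) (fun n z => ?_) (fun m n => ?_)
    (fun x y hxy => ?_) (fun z => ?_)
  · have h1 := hA _ _ (hRg n z)
    -- Here `w = A R z` and `z = l R z - w`, so pairing with `z` gives `l` times a dissipative term
    -- minus `‖w‖²`.
    set w := (l n : ℂ) • R n z - z with hw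
    have hz : z = (l n : ℂ) • R n z - w := by
      rw [hw]
      abel
    have h2 : (inner ℂ w z).re = l n * (inner ℂ w (R n z)).re - ‖w‖ * ‖w‖ := by
      conv_lhs => rw [hz, inner_sub_right, inner_smul_right, Complex.sub_re, Complex.re_ofReal_mul]
      congr 1
      exact inner_self_eq_norm_mul_norm (𝕜 := ℂ) _
    rw [hPapply, inner_smul_left, Complex.conj_ofReal, Complex.re_ofReal_mul, h2]
    refine mul_nonpos_of_nonneg_of_nonpos (hl n).le ?_
    have h3 := mul_nonpos_of_nonneg_of_nonpos (hl n).le h1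
    have h4 := mul_self_nonneg ‖w‖
    linarith
  · exact ((((hRcomm m n).smul_left _).sub_left (Commute.one_left _)).smul_left _ |>.smul_right _
      |>.sub_right (Commute.one_right _)).smul_right _
  · simp only [hPgraph _ x y hxy]
    exact happrox y
  · obtain ⟨x, y, hxy, h⟩ := hsurj one_pos z
    refine ⟨x, ?_⟩
    rw [← h]
    simpa using hxy

end Resolvent

/-! ### Boundary forms and adjoints of restrictions. -/

section BoundaryForm

variable {E F : Type*} [NormedAddCommGroup E] [InnerProductSpace ℂ E]
  [NormedAddCommGroup F] [InnerProductSpace ℂ F]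

theorem mem_graph_iff_exists {T : E →ₗ.[ℂ] F} {x : E} {y : F} :
    (x, y) ∈ T.graph ↔ ∃ h : x ∈ T.domain, T ⟨x, h⟩ = y := by
  rw [LinearPMap.mem_graph_iff]
  constructor
  · rintro ⟨u, rfl, rfl⟩
    exact ⟨u.2, rfl⟩
  · rintro ⟨h, rfl⟩
    exact ⟨⟨x, h⟩, rfl, rfl⟩

theorem mem_graph_restrictTo {T : E →ₗ.[ℂ] F} {p : Submodule ℂ T.domain} {x : E} {y : F} :
    (x, y) ∈ (restrictTo T p).graph ↔ ∃ h : x ∈ T.domain, ⟨x, h⟩ ∈ p ∧ T ⟨x, h⟩ = y := by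
  rw [LinearPMap.mem_graph_iff]
  constructor
  · rintro ⟨⟨_, u, hu, rfl⟩, rfl, rfl⟩
    exact ⟨u.2, hu, rfl⟩
  · rintro ⟨h, hp, rfl⟩
    exact ⟨⟨x, ⟨x, h⟩, hp, rfl⟩, rfl, rfl⟩

theorem mem_domain_restrictTo {T : E →ₗ.[ℂ] F} {p : Submodule ℂ T.domain} {x : E} :
    x ∈ (restrictTo T p).domain ↔ ∃ h : x ∈ T.domain, ⟨x, h⟩ ∈ p := by
  constructor
  · rintro ⟨u, hu, rfl⟩
    exact ⟨u.2, hu⟩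
  · rintro ⟨h, hp⟩
    exact ⟨⟨x, h⟩, hp, rfl⟩

theorem restrictTo_mono {T : E →ₗ.[ℂ] F} {p q : Submodule ℂ T.domain} (h : p ≤ q) :
    restrictTo T p ≤ restrictTo T q := by
  refine LinearPMap.le_of_le_graph ?_
  rintro ⟨x, y⟩ hxy
  rw [mem_graph_restrictTo] at hxy ⊢
  exact ⟨hxy.1, h hxy.2.1, hxy.2.2⟩

theorem le_restrictTo_of_le {S T : E →ₗ.[ℂ] F} {p : Submodule ℂ T.domain} (h : S ≤ T)
    (hp : ∀ x (hx : x ∈ S.domain), ⟨x, h.1 hx⟩ ∈ p) : S ≤ restrictTo T p := by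
  refine LinearPMap.le_of_le_graph ?_
  rintro ⟨x, y⟩ hxy
  rw [mem_graph_restrictTo]
  have hx := LinearPMap.mem_domain_of_mem_graph hxy
  obtain ⟨u, rfl, rfl⟩ := (LinearPMap.mem_graph_iff _).1 hxy
  exact ⟨h.1 hx, hp _ hx, (h.2 rfl).symm⟩

theorem dense_domain_of_le {S T : E →ₗ.[ℂ] F} (hS : Dense (S.domain : Set E)) (h : S ≤ T) :
    Dense (T.domain : Set E) :=
  hS.mono h.1

theorem eq_and_eq_of_mem_graph {T : E →ₗ.[ℂ] F} {x : E} {y : F} (h : (x, y) ∈ T.graph) :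
    ∃ u : T.domain, (u : E) = x ∧ T u = y :=
  (LinearPMap.mem_graph_iff _).1 h

variable [CompleteSpace E]

/-- Let `ω` be the boundary form of `A = S*`. The adjoint of the restriction of `A` to `p ⊇ dom S`
is the restriction of `A` to the `ω`-annihilator `q` of `p`. -/
theorem adjoint_restrictTo_of_form {S A : E →ₗ.[ℂ] E} (hS : Dense (S.domain : Set E))
    (hA : S.adjoint = A) {ω : A.domain → A.domain → ℂ}
    (hω : ∀ f g : A.domain, inner ℂ (A f) (g : E) - inner ℂ (f : E) (A g) = ω f g)
    {p q : Submodule ℂ A.domain} (hSp : S ≤ restrictTo A p)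
    (hpq : ∀ g, g ∈ q ↔ ∀ f ∈ p, ω f g = 0) : (restrictTo A p).adjoint = restrictTo A q := by
  have hdense := dense_domain_of_le hS hSp
  refine LinearPMap.eq_of_eq_graph ?_
  ext ⟨x, y⟩
  rw [mem_graph_adjoint_iff hdense, mem_graph_restrictTo]
  constructor
  · intro h
    -- The adjoint of an extension of `S` is a restriction of `S* = A`, so only the boundary form is
    -- left to test.
    have hxy : (x, y) ∈ A.graph := by
      rw [← hA, mem_graph_adjoint_iff hS]
      exact fun u v huv => h u v (LinearPMap.le_graph_of_le hSp huv)
    obtain ⟨g, rfl, rfl⟩ := eq_and_eq_of_mem_graph hxy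
    refine ⟨g.2, (hpq g).2 fun f hf => ?_, rfl⟩
    rw [← hω, sub_eq_zero]
    exact h _ _ (mem_graph_restrictTo.2 ⟨f.2, hf, rfl⟩)
  · rintro ⟨hx, hq, rfl⟩ u v huv
    obtain ⟨hu, hp, rfl⟩ := mem_graph_restrictTo.1 huv
    rw [← sub_eq_zero]
    exact (hω ⟨u, hu⟩ ⟨x, hx⟩).trans ((hpq _).1 hq _ hp)

/-- Boundary values vanish on the domain of the minimal operator. -/
theorem IsBoundaryTriplet.eq_zero_of_le {S A : E →ₗ.[ℂ] E} (hS : Dense (S.domain : Set E))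
    (hA : S.adjoint = A) (hSA : S ≤ A) {Γ₀ Γ₁ : A.domain →ₗ[ℂ] F} (h : IsBoundaryTriplet A Γ₀ Γ₁)
    {x : A.domain} (hx : (x : E) ∈ S.domain) : Γ₀ x = 0 ∧ Γ₁ x = 0 := by
  have hSx : S ⟨x, hx⟩ = A x := hSA.2 rfl
  have hform : ∀ f : A.domain, inner ℂ (Γ₁ f) (Γ₀ x) - inner ℂ (Γ₀ f) (Γ₁ x) = 0 := by
    intro f
    rw [← h.green, ← hSx, sub_eq_zero]
    have hf : ((f : E), A f) ∈ S.adjoint.graph := hA.symm ▸ A.mem_graph f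
    rw [mem_graph_adjoint_iff hS] at hf
    have h1 := congrArg (starRingEnd ℂ) (hf _ _ (S.mem_graph ⟨x, hx⟩))
    rw [inner_conj_symm, inner_conj_symm] at h1
    exact h1.symm
  -- Surjectivity supplies test elements that turn the form into `‖Γ₀ x‖²` and, up to sign, `‖Γ₁
  -- x‖²`.
  obtain ⟨f, hf0, hf1⟩ := h.surjective 0 (Γ₀ x)
  obtain ⟨g, hg0, hg1⟩ := h.surjective (Γ₁ x) 0
  have h1 := hform f
  have h2 := hform g
  rw [hf0, hf1, inner_zero_left, sub_zero, inner_self_eq_zero] at h1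
  rw [hg0, hg1, inner_zero_left, zero_sub, neg_eq_zero, inner_self_eq_zero] at h2
  exact ⟨h1, h2⟩

/-- This is `S** ⊆ S`: the orthogonal complement of the graph is the rotated graph of `S*`, and a
closed subspace is its own double complement. The graph is moved to `WithLp 2` because orthogonality
needs the Hilbert norm on the product. -/
theorem mem_graph_of_forall_adjoint [CompleteSpace F] {S : E →ₗ.[ℂ] F}
    (hS : Dense (S.domain : Set E)) (hclosed : S.IsClosed) {x : E} {y : F}
    (h : ∀ u v, (u, v) ∈ S.adjoint.graph → inner ℂ v x = inner ℂ u y) : (x, y) ∈ S.graph := by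
  let M : Submodule ℂ (WithLp 2 (E × F)) :=
    S.graph.comap (WithLp.linearEquiv 2 ℂ (E × F)).toLinearMap
  have hMclosed : IsClosed (M : Set (WithLp 2 (E × F))) :=
    hclosed.preimage (WithLp.prod_continuous_ofLp 2 E F)
  have hMM : Mᗮᗮ = M := by
    rw [Submodule.orthogonal_orthogonal_eq_closure, hMclosed.submodule_topologicalClosure_eq]
  suffices hmem : WithLp.toLp 2 (x, y) ∈ Mᗮᗮ by
    rw [hMM] at hmem
    exact hmem
  intro w hw
  have hg : (w.snd, -w.fst) ∈ S.adjoint.graph := by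
    rw [mem_graph_adjoint_iff hS]
    intro u v huv
    have h1 := hw (WithLp.toLp 2 (u, v)) huv
    rw [WithLp.prod_inner_apply] at h1
    rw [inner_neg_right]
    exact eq_neg_of_add_eq_zero_right h1
  have h1 := h _ _ hg
  rw [inner_neg_left] at h1
  rw [WithLp.prod_inner_apply]
  change inner ℂ w.fst x + inner ℂ w.snd y = 0
  rw [← h1, add_neg_cancel]

/-- The minimal operator is the restriction to vanishing boundary values. -/
theorem IsBoundaryTriplet.mem_domain_of_eq_zero {S A : E →ₗ.[ℂ] E}
    (hS : Dense (S.domain : Set E)) (hclosed : S.IsClosed) (hA : S.adjoint = A)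
    {Γ₀ Γ₁ : A.domain →ₗ[ℂ] F} (h : IsBoundaryTriplet A Γ₀ Γ₁) {x : A.domain}
    (h0 : Γ₀ x = 0) (h1 : Γ₁ x = 0) : (x : E) ∈ S.domain := by
  refine LinearPMap.mem_domain_of_mem_graph
    (mem_graph_of_forall_adjoint hS hclosed (y := A x) fun u v huv => ?_)
  rw [hA] at huv
  obtain ⟨f, rfl, rfl⟩ := eq_and_eq_of_mem_graph huv
  rw [← sub_eq_zero, h.green, h0, h1, inner_zero_right, inner_zero_right, sub_zero]

end BoundaryForm

/-! ### Off-diagonal block operators and their adjoints. -/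

section OffDiagonal

variable {E F : Type*} [NormedAddCommGroup E] [InnerProductSpace ℂ E]
  [NormedAddCommGroup F] [InnerProductSpace ℂ F]

theorem mem_graph_offDiag {B : F →ₗ.[ℂ] E} {C : E →ₗ.[ℂ] F} {x y : WithLp 2 (E × F)} :
    (x, y) ∈ (offDiag B C).graph ↔ (x.snd, y.fst) ∈ B.graph ∧ (x.fst, y.snd) ∈ C.graph := by
  rw [mem_graph_iff_exists, mem_graph_iff_exists, mem_graph_iff_exists]
  constructor
  · rintro ⟨hx, rfl⟩
    exact ⟨⟨hx.2, rfl⟩, ⟨hx.1, rfl⟩⟩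
  · rintro ⟨⟨hb, hb'⟩, ⟨hc, hc'⟩⟩
    refine ⟨⟨hc, hb⟩, ?_⟩
    change WithLp.toLp 2 (B ⟨_, hb⟩, C ⟨_, hc⟩) = y
    rw [hb', hc']
    rfl

theorem mem_graph_smul {T : E →ₗ.[ℂ] F} {c : ℂ} (hc : c ≠ 0) {x : E} {y : F} :
    (x, y) ∈ (c • T).graph ↔ (x, c⁻¹ • y) ∈ T.graph := by
  rw [LinearPMap.mem_graph_iff, LinearPMap.mem_graph_iff]
  constructor
  · rintro ⟨u, rfl, rfl⟩
    refine ⟨u, rfl, ?_⟩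
    rw [LinearPMap.smul_apply, inv_smul_smul₀ hc]
  · rintro ⟨u, rfl, hu⟩
    refine ⟨u, rfl, ?_⟩
    rw [LinearPMap.smul_apply, hu, smul_inv_smul₀ hc]

theorem mem_graph_neg {T : E →ₗ.[ℂ] F} {x : E} {y : F} :
    (x, y) ∈ (-T).graph ↔ (x, -y) ∈ T.graph := by
  rw [LinearPMap.mem_graph_iff, LinearPMap.mem_graph_iff]
  constructor
  · rintro ⟨u, rfl, rfl⟩
    exact ⟨u, rfl, by rw [LinearPMap.neg_apply, neg_neg]⟩
  · rintro ⟨u, rfl, hu⟩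
    exact ⟨u, rfl, by rw [LinearPMap.neg_apply, hu, neg_neg]⟩

theorem neg_I_smul_eq (T : E →ₗ.[ℂ] F) : -(Complex.I • T) = (-Complex.I) • T := by
  refine LinearPMap.eq_of_eq_graph ?_
  ext ⟨x, y⟩
  rw [mem_graph_neg, mem_graph_smul Complex.I_ne_zero,
    mem_graph_smul (neg_ne_zero.2 Complex.I_ne_zero), inv_neg, neg_smul, smul_neg]

theorem dense_domain_of_dense_offDiag {B : F →ₗ.[ℂ] E} {C : E →ₗ.[ℂ] F}
    (h : Dense ((offDiag B C).domain : Set (WithLp 2 (E × F)))) :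
    Dense (C.domain : Set E) := by
  have hc : Continuous fun x : WithLp 2 (E × F) => x.fst := by fun_prop
  have hs : Function.Surjective fun x : WithLp 2 (E × F) => x.fst :=
    fun u => ⟨WithLp.toLp 2 (u, 0), rfl⟩
  refine (hs.denseRange.dense_image hc h).mono ?_
  rintro _ ⟨x, hx, rfl⟩
  exact hx.1

theorem dense_offDiag {B : F →ₗ.[ℂ] E} {C : E →ₗ.[ℂ] F} (hB : Dense (B.domain : Set F))
    (hC : Dense (C.domain : Set E)) :
    Dense ((offDiag B C).domain : Set (WithLp 2 (E × F))) := by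
  have hs : Function.Surjective (WithLp.toLp 2 : E × F → WithLp 2 (E × F)) := fun u => ⟨u.ofLp, rfl⟩
  refine (hs.denseRange.dense_image (WithLp.prod_continuous_toLp 2 E F) (hC.prod hB)).mono ?_
  rintro _ ⟨x, hx, rfl⟩
  exact hx

variable [CompleteSpace E]

/-- The scalar must be nonzero: `0 • T` keeps the domain of `T`, but its adjoint is defined
everywhere. -/
theorem adjoint_smul {T : E →ₗ.[ℂ] F} (hT : Dense (T.domain : Set E)) {c : ℂ} (hc : c ≠ 0) :
    (c • T).adjoint = starRingEnd ℂ c • T.adjoint := by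
  have hT' : Dense ((c • T).domain : Set E) := hT
  have hc' : starRingEnd ℂ c ≠ 0 := (map_ne_zero _).2 hc
  have e : ∀ (x : F) (y u : E) (v : F), inner ℂ v x = inner ℂ u ((starRingEnd ℂ c)⁻¹ • y)
      ↔ inner ℂ (c • v) x = inner ℂ u y := by
    intro x y u v
    rw [inner_smul_left, inner_smul_right, eq_inv_mul_iff_mul_eq₀ hc']
  refine LinearPMap.eq_of_eq_graph ?_
  ext ⟨x, y⟩
  rw [mem_graph_smul hc', mem_graph_adjoint_iff hT', mem_graph_adjoint_iff hT]
  simp only [mem_graph_smul hc, e]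
  constructor
  · intro h u v huv
    exact h u _ (by rwa [inv_smul_smul₀ hc])
  · intro h u v huv
    have h1 := h u _ huv
    rwa [smul_inv_smul₀ hc] at h1

theorem adjoint_I_smul {T : E →ₗ.[ℂ] F} (hT : Dense (T.domain : Set E)) :
    (Complex.I • T).adjoint = -(Complex.I • T.adjoint) := by
  rw [adjoint_smul hT Complex.I_ne_zero, Complex.conj_I, neg_I_smul_eq]

theorem adjoint_neg_I_smul {T : E →ₗ.[ℂ] F} (hT : Dense (T.domain : Set E)) :
    (-(Complex.I • T)).adjoint = Complex.I • T.adjoint := by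
  rw [neg_I_smul_eq, adjoint_smul hT (neg_ne_zero.2 Complex.I_ne_zero), map_neg, Complex.conj_I,
    neg_neg]

/-- Testing with vectors having one zero component decouples the adjoint condition into one
condition for each corner. -/
theorem adjoint_offDiag [CompleteSpace F] {B : F →ₗ.[ℂ] E} {C : E →ₗ.[ℂ] F}
    (hB : Dense (B.domain : Set F)) (hC : Dense (C.domain : Set E)) :
    (offDiag B C).adjoint = offDiag C.adjoint B.adjoint := by
  refine LinearPMap.eq_of_eq_graph ?_
  ext ⟨x, y⟩
  rw [mem_graph_adjoint_iff (dense_offDiag hB hC), mem_graph_offDiag, mem_graph_adjoint_iff hB,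
    mem_graph_adjoint_iff hC]
  simp only [mem_graph_offDiag]
  constructor
  · intro h
    constructor
    · intro u v huv
      have h1 := h (WithLp.toLp 2 (u, 0)) (WithLp.toLp 2 (0, v)) ⟨B.graph.zero_mem, huv⟩
      simpa [WithLp.prod_inner_apply] using h1
    · intro u v huv
      have h1 := h (WithLp.toLp 2 (0, u)) (WithLp.toLp 2 (v, 0)) ⟨huv, C.graph.zero_mem⟩
      simpa [WithLp.prod_inner_apply] using h1
  · rintro ⟨h1, h2⟩ u v ⟨hb, hc⟩
    rw [WithLp.prod_inner_apply, WithLp.prod_inner_apply, add_comm]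
    exact congrArg₂ (· + ·) (h1 _ _ hc) (h2 _ _ hb) |>.trans (add_comm _ _) |>.trans
      (add_comm _ _)

/-- A self-adjoint operator which maps the first summand into the second one by `C`, and whose
domain splits, is `[[0, C*], [C, 0]]`. -/
theorem eq_offDiag_of_isSelfAdjoint [CompleteSpace F]
    {T : WithLp 2 (E × F) →ₗ.[ℂ] WithLp 2 (E × F)} (hT : IsSelfAdjoint T) {C : E →ₗ.[ℂ] F}
    (hC : Dense (C.domain : Set E))
    (hsplit : ∀ x y, (x, y) ∈ T.graph →
      (WithLp.toLp 2 (x.fst, 0), WithLp.toLp 2 (0, y.snd)) ∈ T.graph)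
    (h : ∀ u w, (u, w) ∈ C.graph ↔ (WithLp.toLp 2 (u, 0), WithLp.toLp 2 (0, w)) ∈ T.graph) :
    T = offDiag C.adjoint C := by
  have hdecomp : ∀ x y : WithLp 2 (E × F), (x, y)
      = (WithLp.toLp 2 (0, x.snd), WithLp.toLp 2 (y.fst, 0))
        + (WithLp.toLp 2 (x.fst, 0), WithLp.toLp 2 (0, y.snd)) := by
    intro x y
    refine Prod.ext ?_ ?_
    · apply (WithLp.linearEquiv 2 ℂ (E × F)).injective
      simp
      rfl
    · apply (WithLp.linearEquiv 2 ℂ (E × F)).injective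
      simp
      rfl
  -- Since `T = T*`, membership of `(0, v)` is tested against the graph of `T`. Only the `(u, 0)`
  -- parts of the test vectors contribute, and these are the graph of `C`.
  have hsnd : ∀ v w, (v, w) ∈ C.adjoint.graph
      ↔ (WithLp.toLp 2 (0, v), WithLp.toLp 2 (w, 0)) ∈ T.graph := by
    intro v w
    conv_rhs => rw [← LinearPMap.isSelfAdjoint_def.1 hT]
    rw [mem_graph_adjoint_iff hT.dense_domain, mem_graph_adjoint_iff hC]
    constructor
    · intro h1 a b hab
      have h2 := h1 _ _ ((h _ _).2 (hsplit _ _ hab))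
      simpa [WithLp.prod_inner_apply] using h2
    · intro h1 a b hab
      have h2 := h1 _ _ ((h _ _).1 hab)
      simpa [WithLp.prod_inner_apply] using h2
  refine LinearPMap.eq_of_eq_graph ?_
  ext ⟨x, y⟩
  rw [mem_graph_offDiag, hsnd, h]
  constructor
  · intro hxy
    have h1 := hsplit _ _ hxy
    refine ⟨?_, h1⟩
    have h2 := T.graph.sub_mem hxy h1
    nth_rw 1 [hdecomp x y] at h2
    rwa [add_sub_cancel_right] at h2
  · rintro ⟨h1, h2⟩
    rw [hdecomp x y]
    exact T.graph.add_mem h1 h2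

end OffDiagonal

/-! ### Extensions described by a boundary triplet. -/

section Extensions

variable {E F : Type*} [NormedAddCommGroup E] [InnerProductSpace ℂ E]
  [NormedAddCommGroup F] [InnerProductSpace ℂ F]
  {S A : E →ₗ.[ℂ] E} {Γ₀ Γ₁ : A.domain →ₗ[ℂ] F}

/-- Green's identity with equal arguments: each side is a number minus its conjugate. -/
theorem IsBoundaryTriplet.im_inner (h : IsBoundaryTriplet A Γ₀ Γ₁) (x : A.domain) :
    (inner ℂ (A x) (x : E)).im = (inner ℂ (Γ₁ x) (Γ₀ x)).im := by
  have h1 := congrArg Complex.im (h.green x x)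
  rw [← inner_conj_symm (x : E) (A x), ← inner_conj_symm (Γ₀ x) (Γ₁ x), Complex.sub_im,
    Complex.sub_im, Complex.conj_im, Complex.conj_im] at h1
  linarith

variable [CompleteSpace E]

theorem IsBoundaryTriplet.le_restrictTo (h : IsBoundaryTriplet A Γ₀ Γ₁)
    (hS : Dense (S.domain : Set E)) (hA : S.adjoint = A) (hSA : S ≤ A)
    {p : Submodule ℂ A.domain} (hp : LinearMap.ker Γ₀ ⊓ LinearMap.ker Γ₁ ≤ p) :
    S ≤ restrictTo A p :=
  le_restrictTo_of_le hSA fun _ hx => hp (h.eq_zero_of_le hS hA hSA hx)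

theorem IsBoundaryTriplet.le_restrictTo_eqLocus (h : IsBoundaryTriplet A Γ₀ Γ₁)
    (hS : Dense (S.domain : Set E)) (hA : S.adjoint = A) (hSA : S ≤ A) (L : F →L[ℂ] F) :
    S ≤ restrictTo A (LinearMap.eqLocus Γ₁ (L.toLinearMap ∘ₗ Γ₀)) := by
  refine h.le_restrictTo hS hA hSA fun x hx => ?_
  change Γ₁ x = L (Γ₀ x)
  rw [LinearMap.mem_ker.1 hx.1, LinearMap.mem_ker.1 hx.2, map_zero]

/-- The adjoint of the extension given by `Γ₁ x = L Γ₀ x` is given by `Γ₁ x = L* Γ₀ x`. -/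
theorem IsBoundaryTriplet.adjoint_restrictTo_eqLocus [CompleteSpace F]
    (h : IsBoundaryTriplet A Γ₀ Γ₁) (hS : Dense (S.domain : Set E)) (hA : S.adjoint = A)
    (hSA : S ≤ A) (L : F →L[ℂ] F) :
    (restrictTo A (LinearMap.eqLocus Γ₁ (L.toLinearMap ∘ₗ Γ₀))).adjoint
      = restrictTo A (LinearMap.eqLocus Γ₁ (L.adjoint.toLinearMap ∘ₗ Γ₀)) := by
  refine adjoint_restrictTo_of_form hS hA h.green (h.le_restrictTo_eqLocus hS hA hSA L)
    fun g => ⟨fun hg f hf => ?_, fun hg => ?_⟩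
  · have hf' : Γ₁ f = L (Γ₀ f) := hf
    have hg' : Γ₁ g = L.adjoint (Γ₀ g) := hg
    rw [hf', hg', ContinuousLinearMap.adjoint_inner_right, sub_self]
  · change Γ₁ g = L.adjoint (Γ₀ g)
    refine ext_inner_left ℂ fun a => ?_
    -- Every `a` occurs as `Γ₀ f` within the extension, so the vanishing form reads `⟨L a, Γ₀ g⟩ =
    -- ⟨a, Γ₁ g⟩`.
    obtain ⟨f, hf0, hf1⟩ := h.surjective a (L a)
    have h1 := hg f (by
      change Γ₁ f = L (Γ₀ f)
      rw [hf0, hf1])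
    rw [hf0, hf1, sub_eq_zero] at h1
    rw [ContinuousLinearMap.adjoint_inner_right, h1]

theorem IsBoundaryTriplet.isSelfAdjoint_restrictTo_ker_right [CompleteSpace F]
    (h : IsBoundaryTriplet A Γ₀ Γ₁) (hS : Dense (S.domain : Set E)) (hA : S.adjoint = A)
    (hSA : S ≤ A) : IsSelfAdjoint (restrictTo A (LinearMap.ker Γ₁)) := by
  have e : LinearMap.ker Γ₁
      = LinearMap.eqLocus Γ₁ ((0 : F →L[ℂ] F).toLinearMap ∘ₗ Γ₀) := by
    ext x
    rfl
  rw [LinearPMap.isSelfAdjoint_def, e, h.adjoint_restrictTo_eqLocus hS hA hSA, map_zero]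

/-- The condition `Γ₀ x = 0` is not of the form `Γ₁ x = L Γ₀ x`, so its annihilator is computed
directly. -/
theorem IsBoundaryTriplet.isSelfAdjoint_restrictTo_ker_left
    (h : IsBoundaryTriplet A Γ₀ Γ₁) (hS : Dense (S.domain : Set E)) (hA : S.adjoint = A)
    (hSA : S ≤ A) : IsSelfAdjoint (restrictTo A (LinearMap.ker Γ₀)) := by
  rw [LinearPMap.isSelfAdjoint_def]
  refine adjoint_restrictTo_of_form hS hA h.green (h.le_restrictTo hS hA hSA inf_le_left)
    fun g => ⟨fun hg f hf => ?_, fun hg => ?_⟩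
  · rw [LinearMap.mem_ker.1 hf, LinearMap.mem_ker.1 hg, inner_zero_left, inner_zero_right, sub_self]
  · obtain ⟨f, hf0, hf1⟩ := h.surjective 0 (Γ₀ g)
    have h1 := hg f hf0
    rw [hf0, hf1, inner_zero_left, sub_zero, inner_self_eq_zero] at h1
    exact h1

/-- The extension `Γ₁ x = L Γ₀ x` is, up to the factor `-i`, a semigroup generator as soon as `-iL`
and `iL*` are dissipative. -/
theorem IsBoundaryTriplet.generatesContractionSemigroup [CompleteSpace F]
    (h : IsBoundaryTriplet A Γ₀ Γ₁) (hS : Dense (S.domain : Set E)) (hA : S.adjoint = A)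
    (hSA : S ≤ A) {L : F →L[ℂ] F} (hL : IsDissipative (-(Complex.I • L)))
    (hL' : IsDissipative (Complex.I • L.adjoint)) :
    GeneratesContractionSemigroup
      (-(Complex.I • restrictTo A (LinearMap.eqLocus Γ₁ (L.toLinearMap ∘ₗ Γ₀)))) := by
  set T := restrictTo A (LinearMap.eqLocus Γ₁ (L.toLinearMap ∘ₗ Γ₀)) with hT
  set T' := restrictTo A (LinearMap.eqLocus Γ₁ (L.adjoint.toLinearMap ∘ₗ Γ₀)) with hT'
  have hTdense : Dense (T.domain : Set E) :=
    dense_domain_of_le hS (h.le_restrictTo_eqLocus hS hA hSA L)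
  have hTdense' : Dense (T'.domain : Set E) :=
    dense_domain_of_le hS (h.le_restrictTo_eqLocus hS hA hSA L.adjoint)
  have hadj : T.adjoint = T' := h.adjoint_restrictTo_eqLocus hS hA hSA L
  have hadj' : T'.adjoint = T := by
    have := h.adjoint_restrictTo_eqLocus hS hA hSA L.adjoint
    rwa [ContinuousLinearMap.adjoint_adjoint] at this
  refine generatesContractionSemigroup_of_dissipative hTdense ?_ ?_ ?_
  -- The operator is itself the adjoint of `i T'`, hence closed.
  · rw [← hadj', ← adjoint_I_smul hTdense']
    exact LinearPMap.adjoint_isClosed hTdense'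
  -- The real part of `⟨-iTx, x⟩` is `-Im ⟨Tx, x⟩`, which by `im_inner` is the real part of `⟨-iLa,
  -- a⟩` with `a = Γ₀ x`. The adjoint `iT'` is treated in the same way with `iL*`.
  · intro x y hxy
    rw [mem_graph_neg, mem_graph_smul Complex.I_ne_zero, mem_graph_restrictTo] at hxy
    obtain ⟨hx, hp, hy⟩ := hxy
    have hp' : Γ₁ ⟨x, hx⟩ = L (Γ₀ ⟨x, hx⟩) := hp
    have h1 := h.im_inner ⟨x, hx⟩
    have h2 := hL (Γ₀ ⟨x, hx⟩)
    rw [hp', hy] at h1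
    rw [neg_apply, smul_apply, inner_neg_left, inner_smul_left] at h2
    rw [inner_smul_left, inner_neg_left] at h1
    simp at h1 h2
    linarith
  · intro x y hxy
    rw [adjoint_neg_I_smul hTdense, hadj, mem_graph_smul Complex.I_ne_zero,
      mem_graph_restrictTo] at hxy
    obtain ⟨hx, hp, hy⟩ := hxy
    have hp' : Γ₁ ⟨x, hx⟩ = L.adjoint (Γ₀ ⟨x, hx⟩) := hp
    have h1 := h.im_inner ⟨x, hx⟩
    have h2 := hL' (Γ₀ ⟨x, hx⟩)
    rw [hp', hy] at h1
    rw [smul_apply, inner_smul_left] at h2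
    rw [inner_smul_left] at h1
    simp at h1 h2
    linarith

end Extensions

/-! ### Adjoints of direct sums and of edge operators. -/

section DirectSum

variable {ι : Type*} [Fintype ι] {X : ι → Type*} [∀ j, NormedAddCommGroup (X j)]
  [∀ j, InnerProductSpace ℂ (X j)] {D : ∀ j, X j →ₗ.[ℂ] X j}

theorem mem_graph_directSum {x y : PiLp 2 X} :
    (x, y) ∈ (directSum D).graph ↔ ∀ j, (x j, y j) ∈ (D j).graph := by
  simp only [mem_graph_iff_exists]
  constructor
  · rintro ⟨hx, rfl⟩ j
    exact ⟨hx j, rfl⟩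
  · intro h
    refine ⟨fun j => (h j).1, ?_⟩
    ext j
    exact (h j).2

omit [Fintype ι] in
theorem dense_directSum (hD : ∀ j, Dense ((D j).domain : Set (X j))) :
    Dense ((directSum D).domain : Set (PiLp 2 X)) := by
  have hs : Function.Surjective (WithLp.toLp 2 : (∀ j, X j) → PiLp 2 X) := fun u => ⟨u.ofLp, rfl⟩
  refine (hs.denseRange.dense_image (PiLp.continuous_toLp 2 X)
    (dense_pi Set.univ fun j _ => hD j)).mono ?_
  rintro _ ⟨x, hx, rfl⟩
  exact fun j => hx j (Set.mem_univ j)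

theorem adjoint_directSum [∀ j, CompleteSpace (X j)] (hD : ∀ j, Dense ((D j).domain : Set (X j))) :
    (directSum D).adjoint = directSum fun j => (D j).adjoint := by
  classical
  refine LinearPMap.eq_of_eq_graph ?_
  ext ⟨x, y⟩
  rw [mem_graph_adjoint_iff (dense_directSum hD), mem_graph_directSum]
  simp only [mem_graph_adjoint_iff (hD _), mem_graph_directSum]
  constructor
  · intro h j u v huv
    have h1 := h (WithLp.toLp 2 (Pi.single j u)) (WithLp.toLp 2 (Pi.single j v)) fun i => by
      rcases eq_or_ne i j with rfl | hij
      · simpa using huv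
      · simp [hij]
    rw [PiLp.inner_apply, PiLp.inner_apply, Finset.sum_eq_single j, Finset.sum_eq_single j] at h1
    · simpa using h1
    · intro i _ hij
      simp [hij]
    · simp
    · intro i _ hij
      simp [hij]
    · simp
  · intro h u v huv
    rw [PiLp.inner_apply, PiLp.inner_apply]
    exact Finset.sum_congr rfl fun j _ => h j _ _ (huv j)

end DirectSum

section Edge

variable {X : Type*} [NormedAddCommGroup X] [InnerProductSpace ℂ X] {D : X →ₗ.[ℂ] X}

theorem mem_graph_edgeOp {x y : WithLp 2 (X × X)} :
    (x, y) ∈ (edgeOp D).graph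
      ↔ (x.fst, -(Complex.I • y.snd)) ∈ D.graph ∧ (x.snd, -(Complex.I • y.fst)) ∈ D.graph := by
  rw [edgeOp, mem_graph_offDiag, mem_graph_smul Complex.I_ne_zero,
    mem_graph_smul Complex.I_ne_zero, Complex.inv_I, neg_smul, neg_smul, and_comm]

theorem mem_graph_adjoint_edgeOp [CompleteSpace X] (hD : Dense (D.domain : Set X))
    {x y : WithLp 2 (X × X)} :
    (x, y) ∈ (edgeOp D).adjoint.graph ↔
      (x.fst, Complex.I • y.snd) ∈ D.adjoint.graph ∧
        (x.snd, Complex.I • y.fst) ∈ D.adjoint.graph := by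
  have hID : Dense ((Complex.I • D).domain : Set X) := hD
  rw [edgeOp, adjoint_offDiag hID hID, adjoint_I_smul hD, mem_graph_offDiag, mem_graph_neg,
    mem_graph_neg, mem_graph_smul Complex.I_ne_zero, mem_graph_smul Complex.I_ne_zero,
    Complex.inv_I, neg_smul, neg_smul, smul_neg, smul_neg, neg_neg, neg_neg, and_comm]

end Edge

theorem EdgeGraph.sgn_zero {V E : Type*} [DecidableEq V] (𝒢 : EdgeGraph V E) (j : E) : 𝒢.sgn j (𝒢.ends j 0) = 1 := by
  rw [EdgeGraph.sgn, if_pos rfl]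

theorem EdgeGraph.sgn_one {V E : Type*} [DecidableEq V] (𝒢 : EdgeGraph V E) (j : E) : 𝒢.sgn j (𝒢.ends j 1) = -1 := by
  rw [EdgeGraph.sgn, if_neg (𝒢.ends_ne j), if_pos rfl]

section SumOperator

variable {E : Type*} [Fintype E]
  {X : E → Type*} [∀ j, NormedAddCommGroup (X j)] [∀ j, InnerProductSpace ℂ (X j)]
  {D : ∀ j, X j →ₗ.[ℂ] X j}

/-- The component of an element of `X_⊕ × X_⊕` on the edge `j`. -/
def edgePart (x : WithLp 2 (PiLp 2 X × PiLp 2 X)) (j : E) : WithLp 2 (X j × X j) :=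
  WithLp.toLp 2 (x.fst j, x.snd j)

theorem inner_eq_sum_edgePart (x y : WithLp 2 (PiLp 2 X × PiLp 2 X)) :
    inner ℂ x y = ∑ j, inner ℂ (edgePart x j) (edgePart y j) := by
  rw [WithLp.prod_inner_apply]
  change inner ℂ x.fst y.fst + inner ℂ x.snd y.snd = _
  rw [PiLp.inner_apply, PiLp.inner_apply, ← Finset.sum_add_distrib]
  refine Finset.sum_congr rfl fun j _ => ?_
  rw [WithLp.prod_inner_apply]
  rfl

theorem mem_graph_sumOp {x y : WithLp 2 (PiLp 2 X × PiLp 2 X)} :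
    (x, y) ∈ (sumOp D).graph ↔ ∀ j, (edgePart x j, edgePart y j) ∈ (edgeOp (D j)).graph := by
  rw [sumOp, mem_graph_edgeOp, mem_graph_directSum, mem_graph_directSum]
  simp only [mem_graph_edgeOp]
  exact forall_and.symm

theorem dense_sumOp (hD : ∀ j, Dense ((D j).domain : Set (X j))) :
    Dense ((sumOp D).domain : Set (WithLp 2 (PiLp 2 X × PiLp 2 X))) :=
  dense_offDiag (dense_directSum hD) (dense_directSum hD)

variable [∀ j, CompleteSpace (X j)]

/-- Both the block structure and the direct sum commute with adjoints, so the global adjoint acts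
edge by edge. -/
theorem mem_graph_adjoint_sumOp (hD : ∀ j, Dense ((D j).domain : Set (X j)))
    {x y : WithLp 2 (PiLp 2 X × PiLp 2 X)} :
    (x, y) ∈ (sumOp D).adjoint.graph
      ↔ ∀ j, (edgePart x j, edgePart y j) ∈ (edgeOp (D j)).adjoint.graph := by
  rw [sumOp, mem_graph_adjoint_edgeOp (dense_directSum hD), adjoint_directSum hD,
    mem_graph_directSum, mem_graph_directSum]
  simp only [mem_graph_adjoint_edgeOp (hD _)]
  exact forall_and.symm

end SumOperator

/-! ### Boundary data at the ends of the edges. -/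

section Network

set_option linter.unusedSectionVars false

variable {V E : Type*} [Fintype V] [DecidableEq V] [Fintype E]
  {X : E → Type*} [∀ j, NormedAddCommGroup (X j)] [∀ j, InnerProductSpace ℂ (X j)]
  [∀ j, CompleteSpace (X j)]
  {G : Type*} [NormedAddCommGroup G] [InnerProductSpace ℂ G]
  (𝒢 : EdgeGraph V E) (D : ∀ j, X j →ₗ.[ℂ] X j)
  (Γ : Fin 2 → Fin 2 → ∀ j, (D j).adjoint.domain →ₗ[ℂ] G)

/-- The hypotheses on the edge operators and their boundary maps. -/
structure IsEdgeSystem : Prop where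
  closed : ∀ j, (edgeOp (D j)).IsClosed
  dense : ∀ j, Dense ((edgeOp (D j)).domain : Set (WithLp 2 (X j × X j)))
  symm : ∀ j, edgeOp (D j) ≤ (edgeOp (D j)).adjoint
  triplet : ∀ j, IsBoundaryTriplet (edgeOp (D j)).adjoint
    (edgeΓ₀ (D j) (Γ 0 0 j) (Γ 0 1 j)) (edgeΓ₁ (D j) (Γ 1 0 j) (Γ 1 1 j))

/-- The signed boundary value `sgn (j, v) Γ 1 k j x₁ʲ` at the end `p = (j, k) ∼ v`. -/
noncomputable def endFlux (p : E × Fin 2) : (sumOp D).adjoint.domain →ₗ[ℂ] G :=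
  𝒢.sgn p.1 (𝒢.ends p.1 p.2) • (Γ 1 p.2 p.1 ∘ₗ compSnd D p.1)

/-- The boundary value `Γ 0 k j x₀ʲ` at the end `p = (j, k)`. -/
noncomputable def endValue (p : E × Fin 2) : (sumOp D).adjoint.domain →ₗ[ℂ] G :=
  Γ 0 p.2 p.1 ∘ₗ compFst D p.1

/-- The pairing of the fluxes of `f` with the boundary values of `g`. -/
noncomputable def fluxPairing (f g : (sumOp D).adjoint.domain) : ℂ :=
  ∑ p : E × Fin 2, inner ℂ (endFlux 𝒢 D Γ p f) (endValue D Γ p g)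

variable {𝒢 D Γ}

namespace IsEdgeSystem

variable (h : IsEdgeSystem D Γ)
include h

theorem dense_domain (j : E) : Dense ((D j).domain : Set (X j)) :=
  dense_domain_of_dense_offDiag (h.dense j)

theorem dense_sumOp : Dense ((sumOp D).domain : Set (WithLp 2 (PiLp 2 X × PiLp 2 X))) :=
  PortHam.dense_sumOp h.dense_domain

theorem sumOp_le : sumOp D ≤ (sumOp D).adjoint := by
  refine LinearPMap.le_of_le_graph ?_
  rintro ⟨x, y⟩ hxy
  rw [mem_graph_sumOp] at hxy
  rw [mem_graph_adjoint_sumOp h.dense_domain]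
  exact fun j => LinearPMap.le_graph_of_le (h.symm j) (hxy j)

theorem exists_edgePart (x : (sumOp D).adjoint.domain) (j : E) :
    ∃ u : (edgeOp (D j)).adjoint.domain, (u : WithLp 2 (X j × X j)) = edgePart x j ∧
      (edgeOp (D j)).adjoint u = edgePart ((sumOp D).adjoint x) j ∧
      adjFst (D j) u = compFst D j x ∧ adjSnd (D j) u = compSnd D j x := by
  obtain ⟨u, hu, hu'⟩ := eq_and_eq_of_mem_graph
    ((mem_graph_adjoint_sumOp h.dense_domain).1 ((sumOp D).adjoint.mem_graph x) j)
  refine ⟨u, hu, hu', Subtype.ext ?_, Subtype.ext ?_⟩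
  · exact congrArg WithLp.fst hu
  · exact congrArg WithLp.snd hu

/-- Each edge triplet is surjective, and finitely many edge elements glue to a global one. Since
`sgn` is `1` at end 0 and `-1` at end 1, the fluxes are exactly the components of the edge maps
`edgeΓ₁`. -/
theorem exists_values (a b : E × Fin 2 → G) : ∃ x : (sumOp D).adjoint.domain,
    ∀ p, endValue D Γ p x = a p ∧ endFlux 𝒢 D Γ p x = b p := by
  choose u hu0 hu1 using fun j => (h.triplet j).surjective
    (WithLp.toLp 2 (a (j, 0), a (j, 1))) (WithLp.toLp 2 (b (j, 0), b (j, 1)))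
  have hgraph : ((WithLp.toLp 2 (WithLp.toLp 2 fun j => (u j).1.fst,
        WithLp.toLp 2 fun j => (u j).1.snd) : WithLp 2 (PiLp 2 X × PiLp 2 X)),
      (WithLp.toLp 2 (WithLp.toLp 2 fun j => ((edgeOp (D j)).adjoint (u j)).fst,
        WithLp.toLp 2 fun j => ((edgeOp (D j)).adjoint (u j)).snd) :
          WithLp 2 (PiLp 2 X × PiLp 2 X))) ∈ (sumOp D).adjoint.graph := by
    rw [mem_graph_adjoint_sumOp h.dense_domain]
    exact fun j => (edgeOp (D j)).adjoint.mem_graph (u j)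
  obtain ⟨x, hx, -⟩ := eq_and_eq_of_mem_graph hgraph
  have h0 : ∀ j, compFst D j x = adjFst (D j) (u j) := fun j =>
    Subtype.ext (congrArg (fun w : WithLp 2 (PiLp 2 X × PiLp 2 X) => w.fst j) hx)
  have h1 : ∀ j, compSnd D j x = adjSnd (D j) (u j) := fun j =>
    Subtype.ext (congrArg (fun w : WithLp 2 (PiLp 2 X × PiLp 2 X) => w.snd j) hx)
  refine ⟨x, fun ⟨j, k⟩ => ?_⟩
  fin_cases k
  · refine ⟨?_, ?_⟩
    · change Γ 0 0 j (compFst D j x) = _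
      rw [h0]
      exact congrArg WithLp.fst (hu0 j)
    · change 𝒢.sgn j (𝒢.ends j 0) • Γ 1 0 j (compSnd D j x) = _
      rw [h1, 𝒢.sgn_zero, one_smul]
      exact congrArg WithLp.fst (hu1 j)
  · refine ⟨?_, ?_⟩
    · change Γ 0 1 j (compFst D j x) = _
      rw [h0]
      exact congrArg WithLp.snd (hu0 j)
    · change 𝒢.sgn j (𝒢.ends j 1) • Γ 1 1 j (compSnd D j x) = _
      rw [h1, 𝒢.sgn_one, neg_smul, one_smul]
      exact congrArg WithLp.snd (hu1 j)

theorem green (f g : (sumOp D).adjoint.domain) :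
    inner ℂ ((sumOp D).adjoint f) (g : WithLp 2 (PiLp 2 X × PiLp 2 X))
        - inner ℂ (f : WithLp 2 (PiLp 2 X × PiLp 2 X)) ((sumOp D).adjoint g)
      = fluxPairing 𝒢 D Γ f g - starRingEnd ℂ (fluxPairing 𝒢 D Γ g f) := by
  rw [inner_eq_sum_edgePart, inner_eq_sum_edgePart, ← Finset.sum_sub_distrib, fluxPairing,
    fluxPairing, map_sum]
  simp only [inner_conj_symm]
  rw [← Finset.sum_sub_distrib, Fintype.sum_prod_type]
  refine Finset.sum_congr rfl fun j _ => ?_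
  obtain ⟨u, hu, hu', hu0, hu1⟩ := h.exists_edgePart f j
  obtain ⟨w, hw, hw', hw0, hw1⟩ := h.exists_edgePart g j
  rw [← hu, ← hu', ← hw, ← hw', (h.triplet j).green, Fin.sum_univ_two, WithLp.prod_inner_apply,
    WithLp.prod_inner_apply]
  change inner ℂ (Γ 1 0 j (adjSnd (D j) u)) (Γ 0 0 j (adjFst (D j) w))
      + inner ℂ (-Γ 1 1 j (adjSnd (D j) u)) (Γ 0 1 j (adjFst (D j) w))
      - (inner ℂ (Γ 0 0 j (adjFst (D j) u)) (Γ 1 0 j (adjSnd (D j) w))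
        + inner ℂ (Γ 0 1 j (adjFst (D j) u)) (-Γ 1 1 j (adjSnd (D j) w)))
    = inner ℂ (𝒢.sgn j (𝒢.ends j 0) • Γ 1 0 j (compSnd D j f)) (Γ 0 0 j (compFst D j g))
        - inner ℂ (Γ 0 0 j (compFst D j f)) (𝒢.sgn j (𝒢.ends j 0) • Γ 1 0 j (compSnd D j g))
      + (inner ℂ (𝒢.sgn j (𝒢.ends j 1) • Γ 1 1 j (compSnd D j f)) (Γ 0 1 j (compFst D j g))
        - inner ℂ (Γ 0 1 j (compFst D j f)) (𝒢.sgn j (𝒢.ends j 1) • Γ 1 1 j (compSnd D j g)))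
  rw [𝒢.sgn_zero, 𝒢.sgn_one, hu0, hu1, hw0, hw1]
  simp only [one_smul, neg_smul]
  ring

/-- On the domain of `D_j`, all boundary values vanish and `D_j* = -D_j`. -/
theorem boundary_eq_zero {j : E} {u w : X j} (hu : (u, w) ∈ (D j).graph) :
    (u, -w) ∈ (D j).adjoint.graph ∧
      ∀ hu' : u ∈ (D j).adjoint.domain, ∀ i k, Γ i k j ⟨u, hu'⟩ = 0 := by
  have hI : ∀ z : X j, -(Complex.I • (Complex.I • z)) = z := fun z => by
    rw [smul_smul, Complex.I_mul_I, neg_smul, one_smul, neg_neg]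
  -- The diagonal vector exposes all four boundary maps at once: `edgeΓ₀` sees its first component,
  -- `edgeΓ₁` its second.
  have h0 : ((WithLp.toLp 2 (u, u) : WithLp 2 (X j × X j)),
      (WithLp.toLp 2 (Complex.I • w, Complex.I • w) : WithLp 2 (X j × X j)))
        ∈ (edgeOp (D j)).graph := by
    have hw : (u, -(Complex.I • (Complex.I • w))) ∈ (D j).graph := by rwa [hI]
    exact mem_graph_edgeOp.2 ⟨hw, hw⟩
  have h1 := LinearPMap.le_graph_of_le (h.symm j) h0
  have h2 := (mem_graph_adjoint_edgeOp (h.dense_domain j)).1 h1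
  obtain ⟨z, hz, -⟩ := eq_and_eq_of_mem_graph h1
  have hzero := (h.triplet j).eq_zero_of_le (h.dense j) rfl (h.symm j) (x := z)
    (by rw [hz]; exact LinearPMap.mem_domain_of_mem_graph h0)
  refine ⟨?_, fun hu' => ?_⟩
  · have h3 := h2.1
    rwa [← hI (-w), smul_neg, smul_neg, neg_neg]
  · have hz0 : adjFst (D j) z = ⟨u, hu'⟩ := Subtype.ext (congrArg WithLp.fst hz)
    have hz1 : adjSnd (D j) z = ⟨u, hu'⟩ := Subtype.ext (congrArg WithLp.snd hz)
    have e00 : Γ 0 0 j (adjFst (D j) z) = 0 := congrArg WithLp.fst hzero.1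
    have e01 : Γ 0 1 j (adjFst (D j) z) = 0 := congrArg WithLp.snd hzero.1
    have e10 : Γ 1 0 j (adjSnd (D j) z) = 0 := congrArg WithLp.fst hzero.2
    have e11 : -Γ 1 1 j (adjSnd (D j) z) = 0 := congrArg WithLp.snd hzero.2
    rw [hz0] at e00 e01
    rw [hz1] at e10 e11
    rw [neg_eq_zero] at e11
    intro i k
    fin_cases i <;> fin_cases k <;> assumption

/-- For `(u, 0)` the second boundary map vanishes automatically, so the values `Γ 0 k j` alone
decide whether it lies in the minimal domain. This is why the domain of `D_0` consists of elements
of `dom D_⊕`. -/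
theorem mem_domain_of_boundary_eq_zero {j : E} {u : X j} (hu : u ∈ (D j).adjoint.domain)
    (h0 : ∀ k, Γ 0 k j ⟨u, hu⟩ = 0) : u ∈ (D j).domain := by
  have hg : ((WithLp.toLp 2 (u, 0) : WithLp 2 (X j × X j)),
      (WithLp.toLp 2 (0, -(Complex.I • (D j).adjoint ⟨u, hu⟩)) : WithLp 2 (X j × X j)))
        ∈ (edgeOp (D j)).adjoint.graph := by
    rw [mem_graph_adjoint_edgeOp (h.dense_domain j)]
    constructor
    · change (u, Complex.I • -(Complex.I • (D j).adjoint ⟨u, hu⟩)) ∈ (D j).adjoint.graph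
      rw [smul_neg, smul_smul, Complex.I_mul_I, neg_smul, one_smul, neg_neg]
      exact (D j).adjoint.mem_graph ⟨u, hu⟩
    · change ((0 : X j), Complex.I • (0 : X j)) ∈ (D j).adjoint.graph
      rw [smul_zero]
      exact (D j).adjoint.graph.zero_mem
  obtain ⟨z, hz, -⟩ := eq_and_eq_of_mem_graph hg
  have hz0 : adjFst (D j) z = ⟨u, hu⟩ := Subtype.ext (congrArg WithLp.fst hz)
  have hz1 : adjSnd (D j) z = 0 := Subtype.ext (congrArg WithLp.snd hz)
  have hmem := (h.triplet j).mem_domain_of_eq_zero (h.dense j) (h.closed j) rfl (x := z) (by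
      change WithLp.toLp 2 (Γ 0 0 j (adjFst (D j) z), Γ 0 1 j (adjFst (D j) z)) = 0
      rw [hz0, h0, h0]
      rfl) (by
      change WithLp.toLp 2 (Γ 1 0 j (adjSnd (D j) z), -Γ 1 1 j (adjSnd (D j) z)) = 0
      rw [hz1, map_zero, map_zero, neg_zero]
      rfl)
  rw [hz] at hmem
  exact hmem.1

end IsEdgeSystem

end Network

/-! ### From edge ends to vertices: the vertex triplet and its extensions. -/

section Network

set_option linter.unusedSectionVars false

variable {V E : Type*} [Fintype V] [DecidableEq V] [Fintype E]
  {X : E → Type*} [∀ j, NormedAddCommGroup (X j)] [∀ j, InnerProductSpace ℂ (X j)]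
  [∀ j, CompleteSpace (X j)]
  {G : Type*} [NormedAddCommGroup G] [InnerProductSpace ℂ G]
  {𝒢 : EdgeGraph V E} {D : ∀ j, X j →ₗ.[ℂ] X j}
  {Γ : Fin 2 → Fin 2 → ∀ j, (D j).adjoint.domain →ₗ[ℂ] G}

theorem mem_contSubspace_iff {x : (sumOp D).adjoint.domain} :
    x ∈ contSubspace 𝒢 D Γ ↔ ∀ p q : E × Fin 2, 𝒢.ends p.1 p.2 = 𝒢.ends q.1 q.2 →
      endValue D Γ p x = endValue D Γ q x :=
  ⟨fun h _ _ hpq => h _ _ _ _ hpq, fun h j₁ k₁ j₂ k₂ hpq => h (j₁, k₁) (j₂, k₂) hpq⟩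

theorem endValue_eq_nodeValues {x : (sumOp D).adjoint.domain} (hx : x ∈ contSubspace 𝒢 D Γ)
    (p : E × Fin 2) : endValue D Γ p x = nodeValues 𝒢 D Γ x (𝒢.ends p.1 p.2) :=
  (nodeValues_eq 𝒢 D Γ hx p.1 p.2).symm

theorem nodeValues_eq_endValue (x : (sumOp D).adjoint.domain) (v : V) :
    nodeValues 𝒢 D Γ x v = endValue D Γ (𝒢.exists_end v).choose x := rfl

theorem kirchhoffSums_apply (x : (sumOp D).adjoint.domain) (v : V) :
    kirchhoffSums 𝒢 D Γ x v
      = ∑ p : E × Fin 2 with 𝒢.ends p.1 p.2 = v, endFlux 𝒢 D Γ p x := by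
  change (∑ p : E × Fin 2 with 𝒢.ends p.1 p.2 = v,
    𝒢.sgn p.1 v • (Γ 1 p.2 p.1 ∘ₗ compSnd D p.1)) x = _
  rw [LinearMap.sum_apply]
  refine Finset.sum_congr rfl fun p hp => ?_
  rw [← (Finset.mem_filter.1 hp).2]
  rfl

/-- For vertex-continuous `g` the pairing reduces to the vertices. -/
theorem fluxPairing_eq_inner (f : (sumOp D).adjoint.domain) {g : (sumOp D).adjoint.domain}
    (hg : g ∈ contSubspace 𝒢 D Γ) :
    fluxPairing 𝒢 D Γ f g = inner ℂ (kirchhoffSums 𝒢 D Γ f) (nodeValues 𝒢 D Γ g) := by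
  rw [PiLp.inner_apply, fluxPairing,
    ← Finset.sum_fiberwise Finset.univ fun p : E × Fin 2 => 𝒢.ends p.1 p.2]
  refine Finset.sum_congr rfl fun v _ => ?_
  rw [kirchhoffSums_apply, sum_inner]
  refine Finset.sum_congr rfl fun p hp => ?_
  rw [endValue_eq_nodeValues hg, (Finset.mem_filter.1 hp).2]

variable (𝒢 D Γ) in
/-- The vertex-continuous elements with vanishing node values and Kirchhoff sums. -/
noncomputable def minSubspace : Submodule ℂ (sumOp D).adjoint.domain :=
  contSubspace 𝒢 D Γ ⊓ (LinearMap.ker (nodeValues 𝒢 D Γ) ⊓ LinearMap.ker (kirchhoffSums 𝒢 D Γ))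

theorem mem_contSubspace_of_endValue_eq_zero {x : (sumOp D).adjoint.domain}
    (hx : ∀ p, endValue D Γ p x = 0) :
    x ∈ contSubspace 𝒢 D Γ ∧ nodeValues 𝒢 D Γ x = 0 := by
  refine ⟨mem_contSubspace_iff.2 fun p q _ => by rw [hx, hx], ?_⟩
  ext v
  exact hx _

namespace IsEdgeSystem

theorem exists_nodeValues (h : IsEdgeSystem D Γ) (a b : PiLp 2 fun _ : V => G) :
    ∃ x : (sumOp D).adjoint.domain, x ∈ contSubspace 𝒢 D Γ ∧
      nodeValues 𝒢 D Γ x = a ∧ kirchhoffSums 𝒢 D Γ x = b := by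
  classical
  -- The value `a v` is placed at every end at `v`, while the whole flux `b v` is carried by one
  -- chosen end there.
  obtain ⟨x, hx⟩ := h.exists_values (𝒢 := 𝒢) (fun p => a (𝒢.ends p.1 p.2))
    fun p => if p = (𝒢.exists_end (𝒢.ends p.1 p.2)).choose then b (𝒢.ends p.1 p.2) else 0
  refine ⟨x, mem_contSubspace_iff.2 fun p q hpq => by rw [(hx p).1, (hx q).1, hpq], ?_, ?_⟩
  · ext v
    rw [nodeValues_eq_endValue, (hx _).1, (𝒢.exists_end v).choose_spec]
  · ext v
    rw [kirchhoffSums_apply, Finset.sum_eq_single (𝒢.exists_end v).choose]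
    · rw [(hx _).2, (𝒢.exists_end v).choose_spec, if_pos rfl]
    · intro p hp hne
      rw [(hx p).2, (Finset.mem_filter.1 hp).2, if_neg hne]
    · intro hv
      exact (hv (Finset.mem_filter.2 ⟨Finset.mem_univ _, (𝒢.exists_end v).choose_spec⟩)).elim

theorem sumOp_le_restrictTo (h : IsEdgeSystem D Γ) {p : Submodule ℂ (sumOp D).adjoint.domain}
    (hp : minSubspace 𝒢 D Γ ≤ p) : sumOp D ≤ restrictTo (sumOp D).adjoint p := by
  refine le_restrictTo_of_le h.sumOp_le fun x hx => hp ?_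
  have h0 : ∀ q, endValue D Γ q ⟨x, h.sumOp_le.1 hx⟩ = 0 := fun q =>
    (h.boundary_eq_zero ((D q.1).mem_graph ⟨x.fst q.1, hx.1 q.1⟩)).2 _ _ _
  have h1 : ∀ q, endFlux 𝒢 D Γ q ⟨x, h.sumOp_le.1 hx⟩ = 0 := by
    intro q
    change 𝒢.sgn q.1 _ • Γ 1 q.2 q.1 (compSnd D q.1 _) = 0
    have h2 : Γ 1 q.2 q.1 (compSnd D q.1 ⟨x, h.sumOp_le.1 hx⟩) = 0 :=
      (h.boundary_eq_zero ((D q.1).mem_graph ⟨x.snd q.1, hx.2 q.1⟩)).2 _ _ _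
    rw [h2, smul_zero]
  have h2 := mem_contSubspace_of_endValue_eq_zero (𝒢 := 𝒢) h0
  refine ⟨h2.1, h2.2, ?_⟩
  rw [SetLike.mem_coe, LinearMap.mem_ker]
  ext v
  rw [kirchhoffSums_apply, Finset.sum_eq_zero fun q _ => h1 q]
  rfl

theorem mem_contSubspace_iff_form (h : IsEdgeSystem D Γ) (g : (sumOp D).adjoint.domain) :
    g ∈ contSubspace 𝒢 D Γ ↔ ∀ f ∈ minSubspace 𝒢 D Γ,
      fluxPairing 𝒢 D Γ f g - starRingEnd ℂ (fluxPairing 𝒢 D Γ g f) = 0 := by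
  classical
  constructor
  · rintro hg f ⟨hf, hf0, hf1⟩
    rw [fluxPairing_eq_inner f hg, fluxPairing_eq_inner g hf, LinearMap.mem_ker.1 hf0,
      LinearMap.mem_ker.1 hf1, inner_zero_left, inner_zero_right, map_zero, sub_zero]
  · intro hg
    refine mem_contSubspace_iff.2 fun p q hpq => ?_
    set c := endValue D Γ p g - endValue D Γ q g with hc
    -- Opposite fluxes `c` and `-c` at two ends of the same vertex cancel in the Kirchhoff sum, so
    -- `f` lies in `minSubspace`; its pairing with `g` is `‖c‖²`.
    obtain ⟨f, hf⟩ := h.exists_values (𝒢 := 𝒢) 0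
      ((Pi.single p c : E × Fin 2 → G) - Pi.single q c)
    have hf0 := mem_contSubspace_of_endValue_eq_zero (𝒢 := 𝒢) fun p => (hf p).1
    have hfK : kirchhoffSums 𝒢 D Γ f = 0 := by
      ext v
      rw [kirchhoffSums_apply]
      simp only [(hf _).2, Pi.sub_apply, Finset.sum_sub_distrib, Finset.sum_pi_single',
        Finset.mem_filter, Finset.mem_univ, true_and, hpq, sub_self]
      rfl
    have h1 := hg f ⟨hf0.1, hf0.2, hfK⟩
    rw [fluxPairing_eq_inner g hf0.1, hf0.2, inner_zero_right, map_zero, sub_zero,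
      fluxPairing] at h1
    simp only [(hf _).2, Pi.sub_apply, inner_sub_left, Finset.sum_sub_distrib] at h1
    rw [Finset.sum_eq_single p, Finset.sum_eq_single q, Pi.single_eq_same, Pi.single_eq_same,
      ← inner_sub_right, inner_self_eq_zero] at h1
    · exact sub_eq_zero.1 h1
    all_goals first | exact fun h' => absurd (Finset.mem_univ _) h' | skip
    all_goals
      intro r _ hr
      rw [Pi.single_eq_of_ne hr, inner_zero_left]

theorem mem_minSubspace_iff_form (h : IsEdgeSystem D Γ) (f : (sumOp D).adjoint.domain) :
    f ∈ minSubspace 𝒢 D Γ ↔ ∀ g ∈ contSubspace 𝒢 D Γ,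
      fluxPairing 𝒢 D Γ g f - starRingEnd ℂ (fluxPairing 𝒢 D Γ f g) = 0 := by
  classical
  constructor
  · intro hf g hg
    have h1 := congrArg (starRingEnd ℂ) ((h.mem_contSubspace_iff_form g).1 hg f hf)
    rw [map_sub, Complex.conj_conj, map_zero] at h1
    rw [← neg_sub, h1, neg_zero]
  · intro hf
    have hf0 : ∀ p, endValue D Γ p f = 0 := by
      intro p
      -- An element with zero values is continuous whatever its fluxes, so a flux at a single end
      -- isolates the value of `f` there.
      obtain ⟨g, hg⟩ := h.exists_values (𝒢 := 𝒢) 0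
        (Pi.single p (endValue D Γ p f) : E × Fin 2 → G)
      have hg0 := mem_contSubspace_of_endValue_eq_zero (𝒢 := 𝒢) fun p => (hg p).1
      have h1 := hf g hg0.1
      rw [fluxPairing_eq_inner f hg0.1, hg0.2, inner_zero_right, map_zero, sub_zero,
        fluxPairing, Finset.sum_eq_single p, (hg p).2, Pi.single_eq_same,
        inner_self_eq_zero] at h1
      · exact h1
      · intro r _ hr
        rw [(hg r).2, Pi.single_eq_of_ne hr, inner_zero_left]
      · exact fun h' => absurd (Finset.mem_univ _) h'
    have hf1 := mem_contSubspace_of_endValue_eq_zero (𝒢 := 𝒢) hf0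
    refine ⟨hf1.1, hf1.2, ?_⟩
    -- With the values of `f` gone, node values of `g` equal to the Kirchhoff sums of `f` leave only
    -- the squared norm of these sums.
    obtain ⟨g, hg, hg0, -⟩ := h.exists_nodeValues (𝒢 := 𝒢) (kirchhoffSums 𝒢 D Γ f) 0
    have h1 := hf g hg
    rw [fluxPairing_eq_inner f hg, fluxPairing_eq_inner g hf1.1, hf1.2, inner_zero_right, hg0,
      zero_sub, neg_eq_zero, map_eq_zero, inner_self_eq_zero] at h1
    exact h1

variable (𝒢) in
theorem adjoint_minOp (h : IsEdgeSystem D Γ) :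
    (restrictTo (sumOp D).adjoint (minSubspace 𝒢 D Γ)).adjoint = contOp 𝒢 D Γ :=
  adjoint_restrictTo_of_form h.dense_sumOp rfl h.green (h.sumOp_le_restrictTo le_rfl)
    h.mem_contSubspace_iff_form

theorem adjoint_contOp (h : IsEdgeSystem D Γ) :
    (contOp 𝒢 D Γ).adjoint = restrictTo (sumOp D).adjoint (minSubspace 𝒢 D Γ) :=
  adjoint_restrictTo_of_form h.dense_sumOp rfl h.green (h.sumOp_le_restrictTo inf_le_left)
    h.mem_minSubspace_iff_form

variable (𝒢) in
theorem minOp_le_contOp :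
    restrictTo (sumOp D).adjoint (minSubspace 𝒢 D Γ) ≤ contOp 𝒢 D Γ :=
  restrictTo_mono inf_le_left

theorem dense_contOp (h : IsEdgeSystem D Γ) :
    Dense ((contOp 𝒢 D Γ).domain : Set (WithLp 2 (PiLp 2 X × PiLp 2 X))) :=
  dense_domain_of_le h.dense_sumOp (h.sumOp_le_restrictTo inf_le_left)

theorem isClosed_minOp (h : IsEdgeSystem D Γ) :
    (restrictTo (sumOp D).adjoint (minSubspace 𝒢 D Γ)).IsClosed := by
  rw [← h.adjoint_contOp]
  exact LinearPMap.adjoint_isClosed h.dense_contOp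

variable (𝒢) in
theorem dense_minOp (h : IsEdgeSystem D Γ) :
    Dense ((restrictTo (sumOp D).adjoint (minSubspace 𝒢 D Γ)).domain :
      Set (WithLp 2 (PiLp 2 X × PiLp 2 X))) :=
  dense_domain_of_le h.dense_sumOp (h.sumOp_le_restrictTo le_rfl)

variable (𝒢) in
theorem isBoundaryTriplet_contOp (h : IsEdgeSystem D Γ) :
    IsBoundaryTriplet (contOp 𝒢 D Γ) (vertexΓ₀ 𝒢 D Γ) (vertexΓ₁ 𝒢 D Γ) where
  surjective a b := by
    obtain ⟨x, hx, h0, h1⟩ := h.exists_nodeValues (𝒢 := 𝒢) a b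
    exact ⟨⟨x, ⟨x, hx, rfl⟩⟩, h0, h1⟩
  green := by
    rintro ⟨_, f, hf, rfl⟩ ⟨_, g, hg, rfl⟩
    have h1 := h.green (𝒢 := 𝒢) f g
    rw [fluxPairing_eq_inner f hg, fluxPairing_eq_inner g hf, inner_conj_symm] at h1
    exact h1

theorem sumOp_le_contOp_restrictTo (h : IsEdgeSystem D Γ)
    {p : Submodule ℂ (contOp 𝒢 D Γ).domain}
    (hp : LinearMap.ker (vertexΓ₀ 𝒢 D Γ) ⊓ LinearMap.ker (vertexΓ₁ 𝒢 D Γ) ≤ p) :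
    sumOp D ≤ restrictTo (contOp 𝒢 D Γ) p :=
  (h.sumOp_le_restrictTo le_rfl).trans ((h.isBoundaryTriplet_contOp 𝒢).le_restrictTo
    (h.dense_minOp 𝒢) (h.adjoint_minOp 𝒢) (minOp_le_contOp 𝒢) hp)

/-- `S_⊕*` sends `(u, 0)` to `(0, -i D_⊕* u)`, and `maxOp` is `-D_⊕*`; hence `w` is `i` times the
value of `maxOp` at `u`. -/
theorem mem_graph_maxOp (h : IsEdgeSystem D Γ) {u w : PiLp 2 X} :
    (u, (Complex.I)⁻¹ • w) ∈ (maxOp D).graph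
      ↔ (WithLp.toLp 2 (u, 0), WithLp.toLp 2 (0, w)) ∈ (sumOp D).adjoint.graph := by
  rw [maxOp, mem_graph_neg, mem_graph_directSum, mem_graph_adjoint_sumOp h.dense_domain]
  simp only [mem_graph_adjoint_edgeOp (h.dense_domain _)]
  refine forall_congr' fun j => ?_
  rw [Complex.inv_I, neg_smul, neg_neg]
  have h0 : ((0 : X j), Complex.I • (0 : X j)) ∈ (D j).adjoint.graph := by
    rw [smul_zero]
    exact (D j).adjoint.graph.zero_mem
  exact (and_iff_left h0).symm

/-- On `dom D_j` the adjoint acts as `-D_j`, which explains the sign in `maxOp`, and all boundary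
values vanish. -/
theorem directSum_le_zeroD (h : IsEdgeSystem D Γ) : directSum D ≤ zeroD D Γ := by
  refine LinearPMap.le_of_le_graph ?_
  rintro ⟨u, w⟩ hu
  rw [mem_graph_directSum] at hu
  have hmax : (u, w) ∈ (maxOp D).graph := by
    rw [maxOp, mem_graph_neg, mem_graph_directSum]
    exact fun j => (h.boundary_eq_zero (hu j)).1
  obtain ⟨z, rfl, rfl⟩ := eq_and_eq_of_mem_graph hmax
  exact mem_graph_restrictTo.2 ⟨z.2, fun j k => (h.boundary_eq_zero (hu j)).2 _ _ _, rfl⟩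

variable (𝒢) in
theorem zeroD_le_nodeD : zeroD D Γ ≤ nodeD 𝒢 D Γ :=
  restrictTo_mono fun _ hx j₁ k₁ j₂ k₂ _ => (hx j₁ k₁).trans (hx j₂ k₂).symm

theorem mem_zeroD_domain (h : IsEdgeSystem D Γ) {x : PiLp 2 X} :
    x ∈ (zeroD D Γ).domain ↔ x ∈ (directSum D).domain ∧
      ∀ j k, ∃ h : x j ∈ (D j).adjoint.domain, Γ 0 k j ⟨x j, h⟩ = 0 := by
  rw [zeroD, mem_domain_restrictTo]
  constructor
  · rintro ⟨hx, h0⟩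
    exact ⟨fun j => h.mem_domain_of_boundary_eq_zero (hx j) (h0 j), fun j k => ⟨hx j, h0 j k⟩⟩
  · rintro ⟨hx, h0⟩
    exact ⟨fun j => (h0 j 0).1, fun j k => (h0 j k).2⟩

theorem mem_graph_nodeOp {x y : WithLp 2 (PiLp 2 X × PiLp 2 X)} :
    (x, y) ∈ (nodeOp 𝒢 D Γ).graph ↔ ∃ z : (sumOp D).adjoint.domain, (z : WithLp 2 _) = x ∧
      (sumOp D).adjoint z = y ∧ z ∈ contSubspace 𝒢 D Γ ∧ kirchhoffSums 𝒢 D Γ z = 0 := by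
  rw [nodeOp, mem_graph_restrictTo]
  constructor
  · rintro ⟨⟨z, hz, rfl⟩, hK, rfl⟩
    exact ⟨z, rfl, rfl, hz, hK⟩
  · rintro ⟨z, rfl, rfl, hz, hK⟩
    exact ⟨⟨z, hz, rfl⟩, hK, rfl⟩

theorem mem_graph_zeroOp {x y : WithLp 2 (PiLp 2 X × PiLp 2 X)} :
    (x, y) ∈ (zeroOp 𝒢 D Γ).graph ↔ ∃ z : (sumOp D).adjoint.domain, (z : WithLp 2 _) = x ∧
      (sumOp D).adjoint z = y ∧ ∀ p, endValue D Γ p z = 0 := by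
  rw [zeroOp, mem_graph_restrictTo]
  constructor
  · rintro ⟨⟨z, hz, rfl⟩, h0, rfl⟩
    refine ⟨z, rfl, rfl, fun p => ?_⟩
    have h0' : nodeValues 𝒢 D Γ z = 0 := h0
    rw [endValue_eq_nodeValues hz, h0']
    rfl
  · rintro ⟨z, rfl, rfl, hz⟩
    have h0 := mem_contSubspace_of_endValue_eq_zero (𝒢 := 𝒢) hz
    exact ⟨⟨z, h0.1, rfl⟩, h0.2, rfl⟩

/-- The first component of an element of `dom S_⊕*` is again in `dom S_⊕*`. -/
theorem exists_fst_part (h : IsEdgeSystem D Γ) (z : (sumOp D).adjoint.domain) :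
    ∃ z' : (sumOp D).adjoint.domain,
      (z' : WithLp 2 (PiLp 2 X × PiLp 2 X)) = WithLp.toLp 2 (z.1.fst, 0) ∧
      (sumOp D).adjoint z' = WithLp.toLp 2 (0, ((sumOp D).adjoint z).snd) ∧
      (∀ p, endValue D Γ p z' = endValue D Γ p z) ∧ kirchhoffSums 𝒢 D Γ z' = 0 := by
  have hg : ((WithLp.toLp 2 (z.1.fst, 0) : WithLp 2 (PiLp 2 X × PiLp 2 X)),
      (WithLp.toLp 2 (0, ((sumOp D).adjoint z).snd) : WithLp 2 (PiLp 2 X × PiLp 2 X)))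
        ∈ (sumOp D).adjoint.graph := by
    have hz := (mem_graph_adjoint_sumOp h.dense_domain).1 ((sumOp D).adjoint.mem_graph z)
    rw [mem_graph_adjoint_sumOp h.dense_domain]
    intro j
    rw [mem_graph_adjoint_edgeOp (h.dense_domain j)]
    refine ⟨((mem_graph_adjoint_edgeOp (h.dense_domain j)).1 (hz j)).1, ?_⟩
    change ((0 : X j), Complex.I • (0 : X j)) ∈ (D j).adjoint.graph
    rw [smul_zero]
    exact (D j).adjoint.graph.zero_mem
  obtain ⟨z', hz', hz''⟩ := eq_and_eq_of_mem_graph hg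
  refine ⟨z', hz', hz'', fun p => ?_, ?_⟩
  · have e : compFst D p.1 z' = compFst D p.1 z := by
      refine Subtype.ext ?_
      change z'.1.fst p.1 = z.1.fst p.1
      rw [hz']
      rfl
    exact congrArg (Γ 0 p.2 p.1) e
  · ext v
    rw [kirchhoffSums_apply]
    refine Finset.sum_eq_zero fun p _ => ?_
    have e : compSnd D p.1 z' = 0 :=
      Subtype.ext (congrArg (fun w : WithLp 2 (PiLp 2 X × PiLp 2 X) => w.snd p.1) hz')
    change 𝒢.sgn p.1 _ • Γ 1 p.2 p.1 (compSnd D p.1 z') = 0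
    rw [e, map_zero, smul_zero]

theorem isSelfAdjoint_nodeOp [CompleteSpace G] (h : IsEdgeSystem D Γ) :
    IsSelfAdjoint (nodeOp 𝒢 D Γ) :=
  (h.isBoundaryTriplet_contOp 𝒢).isSelfAdjoint_restrictTo_ker_right
    (h.dense_minOp 𝒢) (h.adjoint_minOp 𝒢) (minOp_le_contOp 𝒢)

theorem isSelfAdjoint_zeroOp (h : IsEdgeSystem D Γ) : IsSelfAdjoint (zeroOp 𝒢 D Γ) :=
  (h.isBoundaryTriplet_contOp 𝒢).isSelfAdjoint_restrictTo_ker_left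
    (h.dense_minOp 𝒢) (h.adjoint_minOp 𝒢) (minOp_le_contOp 𝒢)

/-- Dropping `x₁` preserves continuity and makes the Kirchhoff sums zero, so the domain splits and
self-adjointness determines the remaining corner. -/
theorem nodeOp_eq_offDiag [CompleteSpace G] (h : IsEdgeSystem D Γ) :
    nodeOp 𝒢 D Γ
      = offDiag (-(Complex.I • (nodeD 𝒢 D Γ).adjoint)) (Complex.I • nodeD 𝒢 D Γ) := by
  have hdense : Dense ((nodeD 𝒢 D Γ).domain : Set (PiLp 2 X)) :=
    dense_domain_of_le (dense_directSum h.dense_domain)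
      (h.directSum_le_zeroD.trans (zeroD_le_nodeD 𝒢))
  rw [← adjoint_I_smul hdense]
  refine eq_offDiag_of_isSelfAdjoint h.isSelfAdjoint_nodeOp hdense (fun x y hxy => ?_)
    fun u w => ?_
  · obtain ⟨z, rfl, rfl, hz, -⟩ := mem_graph_nodeOp.1 hxy
    obtain ⟨z', hz', hz'', hval, hK⟩ := h.exists_fst_part (𝒢 := 𝒢) z
    refine mem_graph_nodeOp.2 ⟨z', hz', hz'', mem_contSubspace_iff.2 fun p q hpq => ?_, hK⟩
    rw [hval, hval]
    exact mem_contSubspace_iff.1 hz p q hpq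
  · rw [mem_graph_smul Complex.I_ne_zero, nodeD, mem_graph_restrictTo, mem_graph_nodeOp]
    constructor
    · rintro ⟨hu, hcont, hw⟩
      have hg := h.mem_graph_maxOp.1 (mem_graph_iff_exists.2 ⟨hu, hw⟩)
      obtain ⟨z, hz, hzw⟩ := eq_and_eq_of_mem_graph hg
      -- `z'` has the same underlying vector as `z`; it is introduced for its vanishing Kirchhoff
      -- sums.
      obtain ⟨z', hz', hz'', hval, hK⟩ := h.exists_fst_part (𝒢 := 𝒢) z
      rw [hz] at hz'
      rw [hzw] at hz''
      refine ⟨z', hz', hz'', fun j₁ k₁ j₂ k₂ hjk => ?_, hK⟩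
      have e : ∀ j, compFst D j z' = ⟨u j, hu j⟩ := fun j =>
        Subtype.ext (congrArg (fun w : WithLp 2 (PiLp 2 X × PiLp 2 X) => w.fst j) hz')
      rw [e, e]
      exact hcont j₁ k₁ j₂ k₂ hjk
    · rintro ⟨z, hz, hzw, hcont, -⟩
      have hg := (sumOp D).adjoint.mem_graph z
      rw [hz, hzw, ← h.mem_graph_maxOp] at hg
      obtain ⟨hu, hw⟩ := mem_graph_iff_exists.1 hg
      refine ⟨hu, fun j₁ k₁ j₂ k₂ hjk => ?_, hw⟩
      have e : ∀ j, compFst D j z = ⟨u j, hu j⟩ := fun j =>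
        Subtype.ext (congrArg (fun w : WithLp 2 (PiLp 2 X × PiLp 2 X) => w.fst j) hz)
      rw [← e, ← e]
      exact hcont j₁ k₁ j₂ k₂ hjk

/-- Continuity with zero node values means that the value at every end is zero, a condition on `x₀`
alone; `x₁` is unconstrained. -/
theorem zeroOp_eq_offDiag (h : IsEdgeSystem D Γ) :
    zeroOp 𝒢 D Γ = offDiag (-(Complex.I • (zeroD D Γ).adjoint)) (Complex.I • zeroD D Γ) := by
  have hdense : Dense ((zeroD D Γ).domain : Set (PiLp 2 X)) :=
    dense_domain_of_le (dense_directSum h.dense_domain) h.directSum_le_zeroD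
  rw [← adjoint_I_smul hdense]
  refine eq_offDiag_of_isSelfAdjoint h.isSelfAdjoint_zeroOp hdense (fun x y hxy => ?_)
    fun u w => ?_
  · obtain ⟨z, rfl, rfl, hz⟩ := mem_graph_zeroOp.1 hxy
    obtain ⟨z', hz', hz'', hval, -⟩ := h.exists_fst_part (𝒢 := 𝒢) z
    exact mem_graph_zeroOp.2 ⟨z', hz', hz'', fun p => by rw [hval, hz]⟩
  · rw [mem_graph_smul Complex.I_ne_zero, zeroD, mem_graph_restrictTo, mem_graph_zeroOp]
    constructor
    · rintro ⟨hu, h0, hw⟩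
      have hg := h.mem_graph_maxOp.1 (mem_graph_iff_exists.2 ⟨hu, hw⟩)
      obtain ⟨z, hz, hzw⟩ := eq_and_eq_of_mem_graph hg
      refine ⟨z, hz, hzw, fun p => ?_⟩
      have e : compFst D p.1 z = ⟨u p.1, hu p.1⟩ :=
        Subtype.ext (congrArg (fun w : WithLp 2 (PiLp 2 X × PiLp 2 X) => w.fst p.1) hz)
      change Γ 0 p.2 p.1 (compFst D p.1 z) = 0
      rw [e]
      exact h0 p.1 p.2
    · rintro ⟨z, hz, hzw, h0⟩
      have hg := (sumOp D).adjoint.mem_graph z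
      rw [hz, hzw, ← h.mem_graph_maxOp] at hg
      obtain ⟨hu, hw⟩ := mem_graph_iff_exists.1 hg
      refine ⟨hu, fun j k => ?_, hw⟩
      have e : compFst D j z = ⟨u j, hu j⟩ :=
        Subtype.ext (congrArg (fun w : WithLp 2 (PiLp 2 X × PiLp 2 X) => w.fst j) hz)
      rw [← e]
      exact h0 (j, k)

end IsEdgeSystem

end Network

end PortHam

theorem proposition3p1
    {V E : Type*} [Fintype V] [DecidableEq V] [Fintype E]
    {X : E → Type*} [∀ j, NormedAddCommGroup (X j)] [∀ j, InnerProductSpace ℂ (X j)]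
    [∀ j, CompleteSpace (X j)]
    {G : Type*} [NormedAddCommGroup G] [InnerProductSpace ℂ G] [CompleteSpace G]
    (𝒢 : PortHam.EdgeGraph V E)
    (D : ∀ j, X j →ₗ.[ℂ] X j)
    (hclosed : ∀ j, (PortHam.edgeOp (D j)).IsClosed)
    (hdense : ∀ j, Dense ((PortHam.edgeOp (D j)).domain : Set (WithLp 2 (X j × X j))))
    (hsymm : ∀ j, PortHam.edgeOp (D j) ≤ (PortHam.edgeOp (D j)).adjoint)
    (Γ : Fin 2 → Fin 2 → ∀ j, (D j).adjoint.domain →ₗ[ℂ] G)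
    (hΓ : ∀ j, PortHam.IsBoundaryTriplet (PortHam.edgeOp (D j)).adjoint
      (PortHam.edgeΓ₀ (D j) (Γ 0 0 j) (Γ 0 1 j))
      (PortHam.edgeΓ₁ (D j) (Γ 1 0 j) (Γ 1 1 j))) :
    -- (a)
    ((∃ T : WithLp 2 (PiLp 2 X × PiLp 2 X) →ₗ.[ℂ] WithLp 2 (PiLp 2 X × PiLp 2 X),
        T.IsClosed ∧ Dense (T.domain : Set (WithLp 2 (PiLp 2 X × PiLp 2 X))) ∧
        T ≤ T.adjoint ∧ T.adjoint = PortHam.contOp 𝒢 D Γ) ∧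
      PortHam.IsBoundaryTriplet (PortHam.contOp 𝒢 D Γ)
        (PortHam.vertexΓ₀ 𝒢 D Γ) (PortHam.vertexΓ₁ 𝒢 D Γ)) ∧
    -- (b), Kirchhoff current condition
    (IsSelfAdjoint (PortHam.nodeOp 𝒢 D Γ) ∧
      PortHam.sumOp D ≤ PortHam.nodeOp 𝒢 D Γ ∧
      PortHam.directSum D ≤ PortHam.nodeD 𝒢 D Γ ∧
      PortHam.nodeOp 𝒢 D Γ
        = PortHam.offDiag (-(Complex.I • (PortHam.nodeD 𝒢 D Γ).adjoint))
            (Complex.I • PortHam.nodeD 𝒢 D Γ)) ∧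
    -- (b), zero node values
    (IsSelfAdjoint (PortHam.zeroOp 𝒢 D Γ) ∧
      PortHam.sumOp D ≤ PortHam.zeroOp 𝒢 D Γ ∧
      PortHam.directSum D ≤ PortHam.zeroD D Γ ∧
      (∀ x, x ∈ (PortHam.zeroD D Γ).domain ↔ x ∈ (PortHam.directSum D).domain ∧
        ∀ j k, ∃ h : x j ∈ (D j).adjoint.domain, Γ 0 k j ⟨x j, h⟩ = 0) ∧
      PortHam.zeroOp 𝒢 D Γ
        = PortHam.offDiag (-(Complex.I • (PortHam.zeroD D Γ).adjoint))
            (Complex.I • PortHam.zeroD D Γ)) ∧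
    -- (c)
    (∀ (Lv : V → G →L[ℂ] G) (L : PiLp 2 (fun _ : V => G) →L[ℂ] PiLp 2 (fun _ : V => G)),
      L = PortHam.blockDiag Lv →
      PortHam.sumOp D ≤ PortHam.loadOp 𝒢 D Γ L ∧
      (∀ (x : PortHam.contOp 𝒢 D Γ |>.domain)
          (hx : (x : WithLp 2 (PiLp 2 X × PiLp 2 X)) ∈ (PortHam.loadOp 𝒢 D Γ L).domain),
        (inner ℂ (PortHam.loadOp 𝒢 D Γ L ⟨x, hx⟩) (x : WithLp 2 (PiLp 2 X × PiLp 2 X))).im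
          = (inner ℂ (L (PortHam.vertexΓ₀ 𝒢 D Γ x)) (PortHam.vertexΓ₀ 𝒢 D Γ x)).im) ∧
      (PortHam.IsDissipative (-(Complex.I • L)) →
        PortHam.IsDissipative (Complex.I • ContinuousLinearMap.adjoint L) →
        PortHam.GeneratesContractionSemigroup (-(Complex.I • PortHam.loadOp 𝒢 D Γ L)))) := by
  have h : PortHam.IsEdgeSystem D Γ := ⟨hclosed, hdense, hsymm, hΓ⟩
  have hT := h.isBoundaryTriplet_contOp 𝒢
  have hmin := PortHam.IsEdgeSystem.minOp_le_contOp (Γ := Γ) 𝒢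
  -- The symmetric operator in (a) is the restriction to `minSubspace`; its symmetry is its
  -- inclusion in `contOp`, which is its adjoint.
  refine ⟨⟨⟨_, h.isClosed_minOp, h.dense_minOp 𝒢, ?_, h.adjoint_minOp 𝒢⟩, hT⟩,
    ⟨h.isSelfAdjoint_nodeOp, h.sumOp_le_contOp_restrictTo inf_le_right,
      h.directSum_le_zeroD.trans (PortHam.IsEdgeSystem.zeroD_le_nodeD 𝒢), h.nodeOp_eq_offDiag⟩,
    ⟨h.isSelfAdjoint_zeroOp, h.sumOp_le_contOp_restrictTo inf_le_left, h.directSum_le_zeroD,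
      fun _ => h.mem_zeroD_domain, h.zeroOp_eq_offDiag⟩,
    fun _ L _ => ⟨?_, fun x hx => ?_, fun hL hL' => ?_⟩⟩
  · rw [h.adjoint_minOp]
    exact hmin
  · exact (h.sumOp_le_restrictTo le_rfl).trans
      (hT.le_restrictTo_eqLocus (h.dense_minOp 𝒢) (h.adjoint_minOp 𝒢) hmin L)
  · obtain ⟨x', hx', hxx'⟩ := hx
    obtain rfl : x' = x := Subtype.ext hxx'
    have hx'' : PortHam.vertexΓ₁ 𝒢 D Γ x' = L (PortHam.vertexΓ₀ 𝒢 D Γ x') := hx'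
    rw [← hx'']
    exact hT.im_inner x'
  · exact hT.generatesContractionSemigroup (h.dense_minOp 𝒢) (h.adjoint_minOp 𝒢) hmin hL hL'
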